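/- **Theorem (Subject Reduction for $\lambda_{sc}$).** Let $\Sigma$ be a signature context. If $\Gamma\vdash c:\underline C$ and $c\leadsto c'$, then there is a computation type $\underline C'$ such that $\underline C\equiv\underline C'$ and $\Gamma\vdash c':\underline C'$. Here $\lambda_{sc}$ is the following calculus (everything up to renaming of bound variables, with capture-avoiding substitution). *Terms.* Labels $\ell$ are either algebraic ($\ell^{op}$) or scoped ($\ell^{sc}$), never both. Values $v::=()\mid(v_1,v_2)\mid x\mid\lambda x.c\mid\lambda(x,y).c\mid h$; handlers $h::=\mathbf{handler}\{\mathbf{return}\,x\mapsto c_r,\ oprs,\ \mathbf{fwd}\,f\,p\,k\mapsto c_f\}$; operation clauses $oprs::=\cdot\mid\mathbf{op}\,\ell^{op}\,x\,k\mapsto c,oprs\mid\mathbf{sc}\,\ell^{sc}\,x\,p\,k\mapsto c,oprs$; computations $c::=\mathbf{return}\,v\mid\mathbf{op}\,\ell^{op}\,v\,(y.c)\mid\mathbf{sc}\,\ell^{sc}\,v\,(y.c_1)(z.c_2)\mid\mathbf{with}\,v\,\mathbf{handle}\,c\mid\mathbf{do}\,x\leftarrow c_1;c_2\mid v_1\,v_2\mid\mathbf{let}\,x=v\,\mathbf{in}\,c$.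 *Reduction* $c\leadsto c'$ is the least relation with - $(\lambda x.c)\,v\leadsto c[v/x]$; $(\lambda(x,y).c)\,(v_1,v_2)\leadsto c[v_1/x,v_2/y]$; $\mathbf{let}\,x=v\,\mathbf{in}\,c\leadsto c[v/x]$; - $\mathbf{do}\,x\leftarrow c_1;c_2\leadsto\mathbf{do}\,x\leftarrow c_1';c_2$ and $\mathbf{with}\,h\,\mathbf{handle}\,c_1\leadsto\mathbf{with}\,h\,\mathbf{handle}\,c_1'$ whenever $c_1\leadsto c_1'$; - $\mathbf{do}\,x\leftarrow\mathbf{return}\,v;c\leadsto c[v/x]$; $\mathbf{do}\,x\leftarrow\mathbf{op}\,\ell\,v\,(y.c_1);c_2\leadsto\mathbf{op}\,\ell\,v\,(y.\mathbf{do}\,x\leftarrow c_1;c_2)$; $\mathbf{do}\,x\leftarrow\mathbf{sc}\,\ell\,v\,(y.c_1)(z.c_2);c_3\leadsto\mathbf{sc}\,\ell\,v\,(y.c_1)(z.\mathbf{do}\,x\leftarrow c_2;c_3)$; - for $h$ with return clause $\mathbf{return}\,x\mapsto c_r$: $\mathbf{with}\,h\,\mathbf{handle}\,\mathbf{return}\,v\leadsto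 c_r[v/x]$; - $\mathbf{with}\,h\,\mathbf{handle}\,\mathbf{op}\,\ell\,v\,(y.c_1)\leadsto c[v/x,(\lambda y.\mathbf{with}\,h\,\mathbf{handle}\,c_1)/k]$ if $(\mathbf{op}\,\ell\,x\,k\mapsto c)\in h$, and $\leadsto\mathbf{op}\,\ell\,v\,(y.\mathbf{with}\,h\,\mathbf{handle}\,c_1)$ if $h$ has no clause for $\ell$; - $\mathbf{with}\,h\,\mathbf{handle}\,\mathbf{sc}\,\ell\,v\,(y.c_1)(z.c_2)\leadsto c[v/x,(\lambda y.\mathbf{with}\,h\,\mathbf{handle}\,c_1)/p,(\lambda z.\mathbf{with}\,h\,\mathbf{handle}\,c_2)/k]$ if $(\mathbf{sc}\,\ell\,x\,p\,k\mapsto c)\in h$; if $h$ has no clause for $\ell$ and forwarding clause $\mathbf{fwd}\,f\,p\,k\mapsto c_f$, it reduces to $c_f[(\lambda y.\mathbf{with}\,h\,\mathbf{handle}\,c_1)/p,(\lambda z.\mathbf{with}\,h\,\mathbf{handle}\,c_2)/k,(\lambda(p',k').\mathbf{sc}\,\ell\,v\,(y.p'\,y)(z.k'\,z))/f]$. *Types.*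 Value types $A,B,M::=()\mid(A,B)\mid A\to\underline C\mid\underline C\Rightarrow\underline D\mid\alpha\mid\lambda\alpha.A\mid M\,A$; computation types $\underline C::=A!\langle E\rangle$; rows $E::=\cdot\mid\mu\mid\ell;E$; schemes $\sigma::=A\mid\forall\alpha.\sigma\mid\forall\mu.\sigma$. $\Sigma$ assigns to each label at most one signature $A\rightarrowtriangle B$ with closed types $A,B$. Contexts $\Gamma::=\cdot\mid\Gamma,x:\sigma\mid\Gamma,\alpha\mid\Gamma,\mu$. Throughout, contexts are well formed, and all types, rows and schemes occurring in a judgement (and in equivalences used in it) over $\Gamma$ have their free type and row variables declared in $\Gamma$. Row equivalence $\equiv$ is the least congruent equivalence with $\ell_1;\ell_2;E\equiv\ell_2;\ell_1;E$ for $\ell_1\ne\ell_2$; type equivalence $\equiv$ is the least congruent equivalence on types containing row equivalence and $(\lambda\alpha.A)\,B\equiv A[B/\alpha]$. $\ell\in E$ means $E\equiv\ell;E'$ for some $E'$. *Value typing* $\Gamma\vdash v:\sigma$: - $\Gamma\vdash x:\sigma$ if $(x:\sigma)\in\Gamma$; $\Gamma\vdash():()$; $\Gamma\vdash(v_1,v_2):(A,B)$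 if $\Gamma\vdash v_1:A$ and $\Gamma\vdash v_2:B$; - $\Gamma\vdash\lambda x.c:A\to\underline C$ if $\Gamma,x:A\vdash c:\underline C$; $\Gamma\vdash\lambda(x,y).c:(A,B)\to\underline C$ if $\Gamma,x:A,y:B\vdash c:\underline C$; - $\Gamma\vdash v:B$ if $\Gamma\vdash v:A$ and $A\equiv B$; - $\Gamma\vdash v:\sigma[A/\alpha]$ if $\Gamma\vdash v:\forall\alpha.\sigma$, and $\Gamma\vdash v:\sigma[E/\mu]$ if $\Gamma\vdash v:\forall\mu.\sigma$; conversely $\Gamma\vdash v:\forall\alpha.\sigma$ if $\Gamma,\alpha\vdash v:\sigma$ with $\alpha$ fresh for $\Gamma$, and $\Gamma\vdash v:\forall\mu.\sigma$ if $\Gamma,\mu\vdash v:\sigma$ with $\mu$ fresh for $\Gamma$; - $\Gamma\vdash\mathbf{handler}\{\mathbf{return}\,x\mapsto c_r,oprs,\mathbf{fwd}\,f\,p\,k\mapsto c_f\}:\forall\alpha.\,\alpha!\langle F\rangle\Rightarrow M\,\alpha!\langle E\rangle$ if $F\equiv labels(oprs);E$ and, for a fresh $\alpha$ (so $M,E,F$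 are over $\Gamma$), the clauses $\mathbf{return}\,x\mapsto c_r$, $oprs$ and $\mathbf{fwd}\,f\,p\,k\mapsto c_f$ each have type $M\,\alpha!\langle E\rangle$ in $\Gamma,\alpha$. *Clause typing* (fresh type variables $\alpha,\beta,\gamma,\delta$): - $\Gamma\vdash\mathbf{return}\,x\mapsto c_r:M\,A!\langle E\rangle$ if $\Gamma,x:A\vdash c_r:M\,A!\langle E\rangle$; $\Gamma\vdash\cdot:\underline C$; - $\Gamma\vdash\mathbf{op}\,\ell\,x\,k\mapsto c,oprs:\underline C$ if $\Gamma\vdash oprs:\underline C$, $(\ell:A_1\rightarrowtriangle A_2)\in\Sigma$ and $\Gamma,x:A_1,k:A_2\to\underline C\vdash c:\underline C$; - $\Gamma\vdash\mathbf{sc}\,\ell\,x\,p\,k\mapsto c,oprs:M\,A_1!\langle E\rangle$ if $\Gamma\vdash oprs:M\,A_1!\langle E\rangle$, $(\ell:A_2\rightarrowtriangle A_3)\in\Sigma$ and $\Gamma,\beta,x:A_2,p:A_3\to M\,\beta!\langle E\rangle,k:\beta\to M\,A_1!\langle E\rangle\vdash c:M\,A_1!\langle E\rangle$; - $\Gamma\vdash\mathbf{fwd}\,f\,p\,k\mapsto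 c_f:M\,A!\langle E\rangle$ if $\Gamma,\alpha,\beta,p:\alpha\to M\,\beta!\langle E\rangle,k:\beta\to M\,A!\langle E\rangle,f:\forall\gamma\,\delta.(\alpha\to\gamma!\langle E\rangle,\gamma\to\delta!\langle E\rangle)\to\delta!\langle E\rangle\vdash c_f:M\,A!\langle E\rangle$. *Computation typing* $\Gamma\vdash c:\underline C$: - $\Gamma\vdash v_1\,v_2:\underline C$ if $\Gamma\vdash v_1:A\to\underline C$ and $\Gamma\vdash v_2:A$; $\Gamma\vdash\mathbf{let}\,x=v\,\mathbf{in}\,c:\underline C$ if $\Gamma\vdash v:\sigma$ and $\Gamma,x:\sigma\vdash c:\underline C$; - $\Gamma\vdash\mathbf{do}\,x\leftarrow c_1;c_2:B!\langle E\rangle$ if $\Gamma\vdash c_1:A!\langle E\rangle$ and $\Gamma,x:A\vdash c_2:B!\langle E\rangle$; $\Gamma\vdash\mathbf{return}\,v:A!\langle E\rangle$ if $\Gamma\vdash v:A$; - $\Gamma\vdash\mathbf{with}\,v\,\mathbf{handle}\,c:\underline D$ if $\Gamma\vdash v:\underline C\Rightarrow\underline D$ and $\Gamma\vdash c:\underline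 C$; $\Gamma\vdash c:\underline D$ if $\Gamma\vdash c:\underline C$ and $\underline C\equiv\underline D$; - $\Gamma\vdash\mathbf{op}\,\ell\,v\,(y.c):A_3!\langle E\rangle$ if $(\ell:A_1\rightarrowtriangle A_2)\in\Sigma$, $\Gamma\vdash v:A_1$, $\Gamma,y:A_2\vdash c:A_3!\langle E\rangle$ and $\ell\in E$; - $\Gamma\vdash\mathbf{sc}\,\ell\,v\,(y.c_1)(z.c_2):A_4!\langle E\rangle$ if $(\ell:A_1\rightarrowtriangle A_2)\in\Sigma$, $\Gamma\vdash v:A_1$, $\Gamma,y:A_2\vdash c_1:A_3!\langle E\rangle$, $\Gamma,z:A_3\vdash c_2:A_4!\langle E\rangle$ and $\ell\in E$. -/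

import Mathlib

/-!
The calculus `λ_sc` of algebraic and scoped effects and handlers, with generalized forwarding
clauses: syntax, small-step semantics, and declarative type-and-effect system.

Bound variables of all three sorts (term, type and row variables) are de Bruijn indices.
Types are intrinsically well scoped: `Ty r t` is the set of value types whose free row variables
are among `r` given ones and whose free type variables are among `t` given ones, so that for a
typing context `Γ : Ctx r t` the well-scopedness judgement `Γ ⊢ A` reads `A : Ty r t`, and
`Γ ⊢ E` reads `E : Row r`.  Freshness conditions such as `α ∉ Γ` are the weakenings
(`Ctx.tyVar`, `Ctx.rowVar`, `Ty.wk`, ...) that accompany every binder.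
-/

namespace LambdaSc

/-! ### Labels and terms -/

/-- Effect labels; the two constructors keep algebraic and scoped labels apart. -/
inductive Label : Type
  | op (name : ℕ) : Label
  | sc (name : ℕ) : Label

/- Terms.  In a scope that binds several variables, the variable that is written last
has index `0`. -/
mutual

/-- Values. -/
inductive Val : Type
  /-- `()` -/
  | unit : Val
  /-- `(v₁, v₂)` -/
  | pair (v₁ v₂ : Val) : Val
  /-- a variable -/
  | var (x : ℕ) : Val
  /-- `λ x . c` -/
  | lam (c : Comp) : Val
  /-- `λ (x, y) . c`, abstraction over a pair pattern -/
  | lamPair (c : Comp) : Val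
  /-- `handler {return x ↦ cr, ops, fwd f p k ↦ cf}`; the clause body `cr` is in the scope of `x`,
  and `cf` is in the scope of `p`, `k`, `f` (bound in this order, so `f` has index `0`,
  `k` index `1`, `p` index `2`) -/
  | handler (cr : Comp) (ops : Oprs) (cf : Comp) : Val

/-- Computations. -/
inductive Comp : Type
  /-- `return v` -/
  | ret (v : Val) : Comp
  /-- `op ℓ v (y . c)` -/
  | op (l : ℕ) (v : Val) (c : Comp) : Comp
  /-- `sc ℓ v (y . c₁) (z . c₂)` -/
  | sc (l : ℕ) (v : Val) (c₁ c₂ : Comp) : Comp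
  /-- `with v handle c` -/
  | handle (v : Val) (c : Comp) : Comp
  /-- `do x ← c₁ ; c₂` -/
  | seq (c₁ c₂ : Comp) : Comp
  /-- `v₁ v₂` -/
  | app (v₁ v₂ : Val) : Comp
  /-- `let x = v in c` -/
  | letIn (v : Val) (c : Comp) : Comp

/-- Sequences of operation clauses. -/
inductive Oprs : Type
  /-- the empty sequence -/
  | nil : Oprs
  /-- `op ℓ x k ↦ c, ops`; in `c`, `k` has index `0` and `x` index `1` -/
  | op (l : ℕ) (c : Comp) (ops : Oprs) : Oprs
  /-- `sc ℓ x p k ↦ c, ops`; in `c`, `k` has index `0`, `p` index `1` and `x` index `2` -/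
  | sc (l : ℕ) (c : Comp) (ops : Oprs) : Oprs

end

/-- A renaming of term variables under one binder. -/
def liftRen (ρ : ℕ → ℕ) : ℕ → ℕ
  | 0 => 0
  | n + 1 => ρ n + 1

mutual

/-- Renaming of the free variables of a value. -/
def Val.rename (ρ : ℕ → ℕ) : Val → Val
  | .unit => .unit
  | .pair v₁ v₂ => .pair (v₁.rename ρ) (v₂.rename ρ)
  | .var x => .var (ρ x)
  | .lam c => .lam (c.rename (liftRen ρ))
  | .lamPair c => .lamPair (c.rename (liftRen (liftRen ρ)))
  | .handler cr ops cf =>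
      .handler (cr.rename (liftRen ρ)) (ops.rename ρ)
        (cf.rename (liftRen (liftRen (liftRen ρ))))

/-- Renaming of the free variables of a computation. -/
def Comp.rename (ρ : ℕ → ℕ) : Comp → Comp
  | .ret v => .ret (v.rename ρ)
  | .op l v c => .op l (v.rename ρ) (c.rename (liftRen ρ))
  | .sc l v c₁ c₂ => .sc l (v.rename ρ) (c₁.rename (liftRen ρ)) (c₂.rename (liftRen ρ))
  | .handle v c => .handle (v.rename ρ) (c.rename ρ)
  | .seq c₁ c₂ => .seq (c₁.rename ρ) (c₂.rename (liftRen ρ))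
  | .app v₁ v₂ => .app (v₁.rename ρ) (v₂.rename ρ)
  | .letIn v c => .letIn (v.rename ρ) (c.rename (liftRen ρ))

/-- Renaming of the free variables of a sequence of operation clauses. -/
def Oprs.rename (ρ : ℕ → ℕ) : Oprs → Oprs
  | .nil => .nil
  | .op l c ops => .op l (c.rename (liftRen (liftRen ρ))) (ops.rename ρ)
  | .sc l c ops => .sc l (c.rename (liftRen (liftRen (liftRen ρ)))) (ops.rename ρ)

end

/-- Extension of a substitution: index `0` is mapped to `v`, index `n + 1` to `τ n`. -/
def scons (v : Val) (τ : ℕ → Val) : ℕ → Val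
  | 0 => v
  | n + 1 => τ n

/-- A substitution for term variables under one binder. -/
def liftSub (τ : ℕ → Val) : ℕ → Val :=
  scons (.var 0) (fun n => (τ n).rename Nat.succ)

mutual

/-- Simultaneous capture-avoiding substitution in a value. -/
def Val.subst (τ : ℕ → Val) : Val → Val
  | .unit => .unit
  | .pair v₁ v₂ => .pair (v₁.subst τ) (v₂.subst τ)
  | .var x => τ x
  | .lam c => .lam (c.subst (liftSub τ))
  | .lamPair c => .lamPair (c.subst (liftSub (liftSub τ)))
  | .handler cr ops cf =>
      .handler (cr.subst (liftSub τ)) (ops.subst τ)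
        (cf.subst (liftSub (liftSub (liftSub τ))))

/-- Simultaneous capture-avoiding substitution in a computation. -/
def Comp.subst (τ : ℕ → Val) : Comp → Comp
  | .ret v => .ret (v.subst τ)
  | .op l v c => .op l (v.subst τ) (c.subst (liftSub τ))
  | .sc l v c₁ c₂ => .sc l (v.subst τ) (c₁.subst (liftSub τ)) (c₂.subst (liftSub τ))
  | .handle v c => .handle (v.subst τ) (c.subst τ)
  | .seq c₁ c₂ => .seq (c₁.subst τ) (c₂.subst (liftSub τ))
  | .app v₁ v₂ => .app (v₁.subst τ) (v₂.subst τ)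
  | .letIn v c => .letIn (v.subst τ) (c.subst (liftSub τ))

/-- Simultaneous capture-avoiding substitution in a sequence of operation clauses. -/
def Oprs.subst (τ : ℕ → Val) : Oprs → Oprs
  | .nil => .nil
  | .op l c ops => .op l (c.subst (liftSub (liftSub τ))) (ops.subst τ)
  | .sc l c ops => .sc l (c.subst (liftSub (liftSub (liftSub τ)))) (ops.subst τ)

end

/-- `c [v / x]`, where `x` has index `0` in `c`. -/
def Comp.inst (c : Comp) (v : Val) : Comp :=
  c.subst (scons v Val.var)

/-- `c [v / x, w / y]`, where `x` has index `1` and `y` index `0` in `c`. -/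
def Comp.inst₂ (c : Comp) (v w : Val) : Comp :=
  c.subst (scons w (scons v Val.var))

/-- `c [u / x, v / y, w / z]`, where `x` has index `2`, `y` index `1` and `z` index `0` in `c`. -/
def Comp.inst₃ (c : Comp) (u v w : Val) : Comp :=
  c.subst (scons w (scons v (scons u Val.var)))

/-- `(op ℓ x k ↦ c) ∈ ops`. -/
def Oprs.HasOp (l : ℕ) (c : Comp) : Oprs → Prop
  | .nil => False
  | .op l' c' ops => (l' = l ∧ c' = c) ∨ ops.HasOp l c
  | .sc _ _ ops => ops.HasOp l c

/-- `(sc ℓ x p k ↦ c) ∈ ops`. -/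
def Oprs.HasSc (l : ℕ) (c : Comp) : Oprs → Prop
  | .nil => False
  | .op _ _ ops => ops.HasSc l c
  | .sc l' c' ops => (l' = l ∧ c' = c) ∨ ops.HasSc l c

/-! ### Operational semantics -/

/-- `λ y . with h handle c`, where `c` is in the scope of `y`. -/
def Val.handled (h : Val) (c : Comp) : Val :=
  .lam (.handle (h.rename Nat.succ) c)

/-- `λ (p', k') . sc ℓ v (y . p' y) (z . k' z)`. -/
def Val.forwarder (l : ℕ) (v : Val) : Val :=
  .lamPair (.sc l (v.rename (fun n => n + 2))
    (.app (.var 2) (.var 0)) (.app (.var 1) (.var 0)))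

/-- Small-step reduction `c ⇝ c'` of computations. -/
inductive Step : Comp → Comp → Prop
  /-- `(λ x . c) v ⇝ c [v / x]` -/
  | appAbs (c : Comp) (v : Val) :
      Step (.app (.lam c) v) (c.inst v)
  /-- `(λ (x, y) . c) (v₁, v₂) ⇝ c [v₁ / x, v₂ / y]` -/
  | appAbsPair (c : Comp) (v₁ v₂ : Val) :
      Step (.app (.lamPair c) (.pair v₁ v₂)) (c.inst₂ v₁ v₂)
  /-- `let x = v in c ⇝ c [v / x]` -/
  | letIn (v : Val) (c : Comp) :
      Step (.letIn v c) (c.inst v)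
  /-- `do x ← c₁ ; c₂ ⇝ do x ← c₁' ; c₂` if `c₁ ⇝ c₁'` -/
  | seq {c₁ c₁' : Comp} (c₂ : Comp) :
      Step c₁ c₁' → Step (.seq c₁ c₂) (.seq c₁' c₂)
  /-- `do x ← return v ; c₂ ⇝ c₂ [v / x]` -/
  | seqRet (v : Val) (c₂ : Comp) :
      Step (.seq (.ret v) c₂) (c₂.inst v)
  /-- `do x ← op ℓ v (y . c₁) ; c₂ ⇝ op ℓ v (y . do x ← c₁ ; c₂)` -/
  | seqOp (l : ℕ) (v : Val) (c₁ c₂ : Comp) :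
      Step (.seq (.op l v c₁) c₂)
        (.op l v (.seq c₁ (c₂.rename (liftRen Nat.succ))))
  /-- `do x ← sc ℓ v (y . c₁) (z . c₂) ; c₃ ⇝ sc ℓ v (y . c₁) (z . do x ← c₂ ; c₃)` -/
  | seqSc (l : ℕ) (v : Val) (c₁ c₂ c₃ : Comp) :
      Step (.seq (.sc l v c₁ c₂) c₃)
        (.sc l v c₁ (.seq c₂ (c₃.rename (liftRen Nat.succ))))
  /-- `with h handle c ⇝ with h handle c'` if `c ⇝ c'` -/
  | hand (cr : Comp) (ops : Oprs) (cf : Comp) {c c' : Comp} :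
      Step c c' → Step (.handle (.handler cr ops cf) c) (.handle (.handler cr ops cf) c')
  /-- `with h handle return v ⇝ cr [v / x]` if `(return x ↦ cr) ∈ h` -/
  | handRet (cr : Comp) (ops : Oprs) (cf : Comp) (v : Val) :
      Step (.handle (.handler cr ops cf) (.ret v)) (cr.inst v)
  /-- `with h handle op ℓ v (y . c₁) ⇝ c [v / x, (λ y . with h handle c₁) / k]`
  if `(op ℓ x k ↦ c) ∈ h` -/
  | handOp (cr : Comp) (ops : Oprs) (cf : Comp) (l : ℕ) (v : Val) (c₁ c : Comp) :
      ops.HasOp l c →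
      Step (.handle (.handler cr ops cf) (.op l v c₁))
        (c.inst₂ v ((Val.handler cr ops cf).handled c₁))
  /-- `with h handle op ℓ v (y . c₁) ⇝ op ℓ v (y . with h handle c₁)` if `h` has no clause
  for the algebraic label `ℓ` -/
  | fwdOp (cr : Comp) (ops : Oprs) (cf : Comp) (l : ℕ) (v : Val) (c₁ : Comp) :
      (¬ ∃ c, ops.HasOp l c) →
      Step (.handle (.handler cr ops cf) (.op l v c₁))
        (.op l v (.handle ((Val.handler cr ops cf).rename Nat.succ) c₁))
  /-- `with h handle sc ℓ v (y . c₁) (z . c₂) ⇝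
  c [v / x, (λ y . with h handle c₁) / p, (λ z . with h handle c₂) / k]`
  if `(sc ℓ x p k ↦ c) ∈ h` -/
  | handSc (cr : Comp) (ops : Oprs) (cf : Comp) (l : ℕ) (v : Val) (c₁ c₂ c : Comp) :
      ops.HasSc l c →
      Step (.handle (.handler cr ops cf) (.sc l v c₁ c₂))
        (c.inst₃ v ((Val.handler cr ops cf).handled c₁) ((Val.handler cr ops cf).handled c₂))
  /-- `with h handle sc ℓ v (y . c₁) (z . c₂) ⇝
  cf [(λ y . with h handle c₁) / p, (λ z . with h handle c₂) / k,
  (λ (p', k') . sc ℓ v (y . p' y) (z . k' z)) / f]`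
  if `h` has no clause for the scoped label `ℓ` and `(fwd f p k ↦ cf) ∈ h` -/
  | fwdSc (cr : Comp) (ops : Oprs) (cf : Comp) (l : ℕ) (v : Val) (c₁ c₂ : Comp) :
      (¬ ∃ c, ops.HasSc l c) →
      Step (.handle (.handler cr ops cf) (.sc l v c₁ c₂))
        (cf.inst₃ ((Val.handler cr ops cf).handled c₁) ((Val.handler cr ops cf).handled c₂)
          (Val.forwarder l v))

/-! ### Types -/

/-- Effect rows over `r` row variables: `·`, `μ`, or `ℓ ; E`. -/
inductive Row (r : ℕ) : Type
  | nil : Row r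
  | var (μ : Fin r) : Row r
  | cons (l : Label) (E : Row r) : Row r

/-- Value types over `r` row variables and `t` type variables.  A computation type `B ! ⟨E⟩`
inside a value type is stored as the two arguments `B` and `E`. -/
inductive Ty (r : ℕ) : ℕ → Type
  /-- `()` -/
  | unit {t : ℕ} : Ty r t
  /-- `(A, B)` -/
  | pair {t : ℕ} (A B : Ty r t) : Ty r t
  /-- `A → B ! ⟨E⟩` -/
  | fn {t : ℕ} (A B : Ty r t) (E : Row r) : Ty r t
  /-- `A ! ⟨F⟩ ⇒ B ! ⟨E⟩` -/
  | hand {t : ℕ} (A : Ty r t) (F : Row r) (B : Ty r t) (E : Row r) : Ty r t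
  /-- a type variable -/
  | var {t : ℕ} (α : Fin t) : Ty r t
  /-- `λ α . A` -/
  | lam {t : ℕ} (A : Ty r (t + 1)) : Ty r t
  /-- `M A` -/
  | app {t : ℕ} (M A : Ty r t) : Ty r t

/-- Computation types `A ! ⟨E⟩`. -/
structure CTy (r t : ℕ) : Type where
  ty : Ty r t
  row : Row r

/-- Type schemes `σ ::= A | ∀ α . σ | ∀ μ . σ`. -/
inductive Scheme : ℕ → ℕ → Type
  | mono {r t : ℕ} (A : Ty r t) : Scheme r t
  | allTy {r t : ℕ} (σ : Scheme r (t + 1)) : Scheme r t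
  | allRow {r t : ℕ} (σ : Scheme (r + 1) t) : Scheme r t

/-- Substitution of rows for row variables in a row. -/
def Row.subst {r r' : ℕ} (η : Fin r → Row r') : Row r → Row r'
  | .nil => .nil
  | .var μ => η μ
  | .cons l E => .cons l (E.subst η)

/-- Renaming of row variables in a row. -/
def Row.rename {r r' : ℕ} (ξ : Fin r → Fin r') : Row r → Row r'
  | .nil => .nil
  | .var μ => .var (ξ μ)
  | .cons l E => .cons l (E.rename ξ)

/-- A renaming of type or row variables under one binder. -/
def liftFin {n n' : ℕ} (ρ : Fin n → Fin n') : Fin (n + 1) → Fin (n' + 1) :=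
  Fin.cases 0 (fun i => (ρ i).succ)

/-- Renaming of row variables (by `ξ`) and type variables (by `ρ`) in a value type. -/
def Ty.rename {r r' : ℕ} (ξ : Fin r → Fin r') :
    {t : ℕ} → Ty r t → {t' : ℕ} → (Fin t → Fin t') → Ty r' t'
  | _, .unit, _, _ => .unit
  | _, .pair A B, _, ρ => .pair (A.rename ξ ρ) (B.rename ξ ρ)
  | _, .fn A B E, _, ρ => .fn (A.rename ξ ρ) (B.rename ξ ρ) (E.rename ξ)
  | _, .hand A F B E, _, ρ =>
      .hand (A.rename ξ ρ) (F.rename ξ) (B.rename ξ ρ) (E.rename ξ)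
  | _, .var α, _, ρ => .var (ρ α)
  | _, .lam A, _, ρ => .lam (A.rename ξ (liftFin ρ))
  | _, .app M A, _, ρ => .app (M.rename ξ ρ) (A.rename ξ ρ)

/-- Weakening of a value type by a fresh type variable. -/
def Ty.wk {r t : ℕ} (A : Ty r t) : Ty r (t + 1) :=
  A.rename id Fin.succ

/-- Weakening of a value type by a fresh row variable. -/
def Ty.wkRow {r t : ℕ} (A : Ty r t) : Ty (r + 1) t :=
  A.rename Fin.succ id

/-- A substitution for type variables under a binder of a type variable. -/
def Ty.lift {r t t' : ℕ} (θ : Fin t → Ty r t') : Fin (t + 1) → Ty r (t' + 1) :=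
  Fin.cases (.var 0) (fun i => (θ i).wk)

/-- A substitution for row variables under a binder of a row variable. -/
def Row.lift {r r' : ℕ} (η : Fin r → Row r') : Fin (r + 1) → Row (r' + 1) :=
  Fin.cases (.var 0) (fun i => (η i).rename Fin.succ)

/-- Simultaneous capture-avoiding substitution for row variables (by `η`) and type variables
(by `θ`) in a value type. -/
def Ty.subst {r r' : ℕ} (η : Fin r → Row r') :
    {t : ℕ} → Ty r t → {t' : ℕ} → (Fin t → Ty r' t') → Ty r' t'
  | _, .unit, _, _ => .unit
  | _, .pair A B, _, θ => .pair (A.subst η θ) (B.subst η θ)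
  | _, .fn A B E, _, θ => .fn (A.subst η θ) (B.subst η θ) (E.subst η)
  | _, .hand A F B E, _, θ =>
      .hand (A.subst η θ) (F.subst η) (B.subst η θ) (E.subst η)
  | _, .var α, _, θ => θ α
  | _, .lam A, _, θ => .lam (A.subst η (Ty.lift θ))
  | _, .app M A, _, θ => .app (M.subst η θ) (A.subst η θ)

/-- `A [B / α]`, where `α` has index `0` in `A`. -/
def Ty.inst {r t : ℕ} (A : Ty r (t + 1)) (B : Ty r t) : Ty r t :=
  A.subst Row.var (Fin.cases B Ty.var)

/-- Renaming of row variables (by `ξ`) and type variables (by `ρ`) in a type scheme. -/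
def Scheme.rename : {r t : ℕ} → Scheme r t → {r' t' : ℕ} →
    (Fin r → Fin r') → (Fin t → Fin t') → Scheme r' t'
  | _, _, .mono A, _, _, ξ, ρ => .mono (A.rename ξ ρ)
  | _, _, .allTy σ, _, _, ξ, ρ => .allTy (σ.rename ξ (liftFin ρ))
  | _, _, .allRow σ, _, _, ξ, ρ => .allRow (σ.rename (liftFin ξ) ρ)

/-- Weakening of a type scheme by a fresh type variable. -/
def Scheme.wkTy {r t : ℕ} (σ : Scheme r t) : Scheme r (t + 1) :=
  σ.rename id Fin.succ

/-- Weakening of a type scheme by a fresh row variable. -/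
def Scheme.wkRow {r t : ℕ} (σ : Scheme r t) : Scheme (r + 1) t :=
  σ.rename Fin.succ id

/-- Simultaneous capture-avoiding substitution for row variables (by `η`) and type variables
(by `θ`) in a type scheme. -/
def Scheme.subst : {r t : ℕ} → Scheme r t → {r' t' : ℕ} →
    (Fin r → Row r') → (Fin t → Ty r' t') → Scheme r' t'
  | _, _, .mono A, _, _, η, θ => .mono (A.subst η θ)
  | _, _, .allTy σ, _, _, η, θ => .allTy (σ.subst η (Ty.lift θ))
  | _, _, .allRow σ, _, _, η, θ => .allRow (σ.subst (Row.lift η) (fun i => (θ i).wkRow))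

/-- `[A / α] σ`, where `α` has index `0` in `σ`. -/
def Scheme.instTy {r t : ℕ} (σ : Scheme r (t + 1)) (A : Ty r t) : Scheme r t :=
  σ.subst Row.var (Fin.cases A Ty.var)

/-- `[E / μ] σ`, where `μ` has index `0` in `σ`. -/
def Scheme.instRow {r t : ℕ} (σ : Scheme (r + 1) t) (E : Row r) : Scheme r t :=
  σ.subst (Fin.cases E Row.var) Ty.var

/-! ### Equivalence of rows and types -/

/-- Row equivalence: rows are identified up to transpositions of distinct labels. -/
inductive RowEq {r : ℕ} : Row r → Row r → Prop
  | refl (E : Row r) : RowEq E E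
  | symm {E F : Row r} : RowEq E F → RowEq F E
  | trans {E₁ E₂ E₃ : Row r} : RowEq E₁ E₂ → RowEq E₂ E₃ → RowEq E₁ E₃
  | head (l : Label) {E F : Row r} : RowEq E F → RowEq (.cons l E) (.cons l F)
  | swap {l₁ l₂ : Label} (E : Row r) :
      l₁ ≠ l₂ → RowEq (.cons l₁ (.cons l₂ E)) (.cons l₂ (.cons l₁ E))

/-- Equivalence of value types: the congruence generated by row equivalence and
`(λ α . A) B ≡ A [B / α]`. -/
inductive TyEq {r : ℕ} : {t : ℕ} → Ty r t → Ty r t → Prop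
  | refl {t : ℕ} (A : Ty r t) : TyEq A A
  | symm {t : ℕ} {A B : Ty r t} : TyEq A B → TyEq B A
  | trans {t : ℕ} {A₁ A₂ A₃ : Ty r t} : TyEq A₁ A₂ → TyEq A₂ A₃ → TyEq A₁ A₃
  | pair {t : ℕ} {A₁ A₂ B₁ B₂ : Ty r t} :
      TyEq A₁ A₂ → TyEq B₁ B₂ → TyEq (.pair A₁ B₁) (.pair A₂ B₂)
  | fn {t : ℕ} {A₁ A₂ B₁ B₂ : Ty r t} {E₁ E₂ : Row r} :
      TyEq A₁ A₂ → TyEq B₁ B₂ → RowEq E₁ E₂ → TyEq (.fn A₁ B₁ E₁) (.fn A₂ B₂ E₂)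
  | hand {t : ℕ} {A₁ A₂ B₁ B₂ : Ty r t} {F₁ F₂ E₁ E₂ : Row r} :
      TyEq A₁ A₂ → RowEq F₁ F₂ → TyEq B₁ B₂ → RowEq E₁ E₂ →
      TyEq (.hand A₁ F₁ B₁ E₁) (.hand A₂ F₂ B₂ E₂)
  | lam {t : ℕ} {A B : Ty r (t + 1)} : TyEq A B → TyEq (.lam A) (.lam B)
  | app {t : ℕ} {M₁ M₂ A B : Ty r t} :
      TyEq M₁ M₂ → TyEq A B → TyEq (.app M₁ A) (.app M₂ B)
  | appAbs {t : ℕ} (A : Ty r (t + 1)) (B : Ty r t) : TyEq (.app (.lam A) B) (A.inst B)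

/-- Equivalence of computation types: `A ! ⟨E⟩ ≡ B ! ⟨F⟩` if `A ≡ B` and `E ≡ F`. -/
structure CTyEq {r t : ℕ} (C D : CTy r t) : Prop where
  ty : TyEq C.ty D.ty
  row : RowEq C.row D.row

/-- `ℓ ∈ E`: the row `E` is equivalent to `ℓ ; E'` for some `E'`. -/
def Row.Mem {r : ℕ} (l : Label) (E : Row r) : Prop :=
  ∃ E' : Row r, RowEq E (.cons l E')

/-- The row `labels(ops) ; E`. -/
def Oprs.labels {r : ℕ} (E : Row r) : Oprs → Row r
  | .nil => E
  | .op l _ ops => .cons (.op l) (ops.labels E)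
  | .sc l _ ops => .cons (.sc l) (ops.labels E)

/-! ### Contexts -/

/-- Signature contexts: at most one signature `A ↣ B`, with closed `A` and `B`, per label. -/
structure Sig : Type where
  op : ℕ → Option (Ty 0 0 × Ty 0 0)
  sc : ℕ → Option (Ty 0 0 × Ty 0 0)

/-- A closed type, seen as a type over arbitrary variables. -/
def Ty.closed (A : Ty 0 0) (r t : ℕ) : Ty r t :=
  A.rename (Fin.elim0 : Fin 0 → Fin r) (Fin.elim0 : Fin 0 → Fin t)

/-- Type contexts `Γ ::= · | Γ, x : σ | Γ, α | Γ, μ`, indexed by the numbers of row and type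
variables that they declare. -/
inductive Ctx : ℕ → ℕ → Type
  | nil : Ctx 0 0
  | ext {r t : ℕ} (Γ : Ctx r t) (σ : Scheme r t) : Ctx r t
  | tyVar {r t : ℕ} (Γ : Ctx r t) : Ctx r (t + 1)
  | rowVar {r t : ℕ} (Γ : Ctx r t) : Ctx (r + 1) t

/-- `(x : σ) ∈ Γ`. -/
inductive Ctx.Has : {r t : ℕ} → Ctx r t → ℕ → Scheme r t → Prop
  | here {r t : ℕ} (Γ : Ctx r t) (σ : Scheme r t) : Has (Γ.ext σ) 0 σ
  | there {r t : ℕ} {Γ : Ctx r t} {x : ℕ} {σ : Scheme r t} (σ' : Scheme r t) :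
      Has Γ x σ → Has (Γ.ext σ') (x + 1) σ
  | tyVar {r t : ℕ} {Γ : Ctx r t} {x : ℕ} {σ : Scheme r t} :
      Has Γ x σ → Has Γ.tyVar x σ.wkTy
  | rowVar {r t : ℕ} {Γ : Ctx r t} {x : ℕ} {σ : Scheme r t} :
      Has Γ x σ → Has Γ.rowVar x σ.wkRow

/-- `Γ, x : A` for a value type `A`. -/
def Ctx.extTy {r t : ℕ} (Γ : Ctx r t) (A : Ty r t) : Ctx r t :=
  Γ.ext (.mono A)

/-- The type scheme `∀ γ δ . (α → γ ! ⟨E⟩, γ → δ ! ⟨E⟩) → δ ! ⟨E⟩` of the variable `f` of a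
forwarding clause, in a context whose last two type variables are `α`, `β`. -/
def fwdScheme {r t : ℕ} (E : Row r) : Scheme r (t + 2) :=
  .allTy (.allTy (.mono
    (.fn (.pair (.fn (.var 3) (.var 1) E) (.fn (.var 1) (.var 0) E)) (.var 0) E)))

/-! ### Typing -/

mutual

/-- Value typing `Γ ⊢ v : σ` (with respect to the signature context `S`). -/
inductive ValTyping (S : Sig) : {r t : ℕ} → Ctx r t → Val → Scheme r t → Prop
  | var {r t : ℕ} {Γ : Ctx r t} {x : ℕ} {σ : Scheme r t} :
      Γ.Has x σ → ValTyping S Γ (.var x) σ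
  | unit {r t : ℕ} {Γ : Ctx r t} : ValTyping S Γ .unit (.mono .unit)
  | pair {r t : ℕ} {Γ : Ctx r t} {v₁ v₂ : Val} {A B : Ty r t} :
      ValTyping S Γ v₁ (.mono A) → ValTyping S Γ v₂ (.mono B) →
      ValTyping S Γ (.pair v₁ v₂) (.mono (.pair A B))
  | abs {r t : ℕ} {Γ : Ctx r t} {c : Comp} {A B : Ty r t} {E : Row r} :
      CompTyping S (Γ.extTy A) c ⟨B, E⟩ →
      ValTyping S Γ (.lam c) (.mono (.fn A B E))
  | absPair {r t : ℕ} {Γ : Ctx r t} {c : Comp} {A₁ A₂ B : Ty r t} {E : Row r} :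
      CompTyping S ((Γ.extTy A₁).extTy A₂) c ⟨B, E⟩ →
      ValTyping S Γ (.lamPair c) (.mono (.fn (.pair A₁ A₂) B E))
  | eqV {r t : ℕ} {Γ : Ctx r t} {v : Val} {A B : Ty r t} :
      ValTyping S Γ v (.mono A) → TyEq A B → ValTyping S Γ v (.mono B)
  | inst {r t : ℕ} {Γ : Ctx r t} {v : Val} {σ : Scheme r (t + 1)} (A : Ty r t) :
      ValTyping S Γ v (.allTy σ) → ValTyping S Γ v (σ.instTy A)
  | gen {r t : ℕ} {Γ : Ctx r t} {v : Val} {σ : Scheme r (t + 1)} :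
      ValTyping S Γ.tyVar v σ → ValTyping S Γ v (.allTy σ)
  | instEff {r t : ℕ} {Γ : Ctx r t} {v : Val} {σ : Scheme (r + 1) t} (E : Row r) :
      ValTyping S Γ v (.allRow σ) → ValTyping S Γ v (σ.instRow E)
  | genEff {r t : ℕ} {Γ : Ctx r t} {v : Val} {σ : Scheme (r + 1) t} :
      ValTyping S Γ.rowVar v σ → ValTyping S Γ v (.allRow σ)
  /-- `Γ ⊢ handler {...} : ∀ α . α ! ⟨F⟩ ⇒ M α ! ⟨E⟩` -/
  | handler {r t : ℕ} {Γ : Ctx r t} {cr : Comp} {ops : Oprs} {cf : Comp}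
      {M : Ty r t} {E F : Row r} :
      RowEq F (ops.labels E) →
      RetTyping S Γ.tyVar cr (.app M.wk (.var 0)) E →
      OprsTyping S Γ.tyVar ops ⟨.app M.wk (.var 0), E⟩ →
      FwdTyping S Γ.tyVar cf (.app M.wk (.var 0)) E →
      ValTyping S Γ (.handler cr ops cf)
        (.allTy (.mono (.hand (.var 0) F (.app M.wk (.var 0)) E)))

/-- Computation typing `Γ ⊢ c : C`. -/
inductive CompTyping (S : Sig) : {r t : ℕ} → Ctx r t → Comp → CTy r t → Prop
  | app {r t : ℕ} {Γ : Ctx r t} {v₁ v₂ : Val} {A B : Ty r t} {E : Row r} :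
      ValTyping S Γ v₁ (.mono (.fn A B E)) → ValTyping S Γ v₂ (.mono A) →
      CompTyping S Γ (.app v₁ v₂) ⟨B, E⟩
  | seq {r t : ℕ} {Γ : Ctx r t} {c₁ c₂ : Comp} {A B : Ty r t} {E : Row r} :
      CompTyping S Γ c₁ ⟨A, E⟩ → CompTyping S (Γ.extTy A) c₂ ⟨B, E⟩ →
      CompTyping S Γ (.seq c₁ c₂) ⟨B, E⟩
  | eqC {r t : ℕ} {Γ : Ctx r t} {c : Comp} {C D : CTy r t} :
      CompTyping S Γ c C → CTyEq C D → CompTyping S Γ c D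
  | letIn {r t : ℕ} {Γ : Ctx r t} {v : Val} {c : Comp} {σ : Scheme r t} {C : CTy r t} :
      ValTyping S Γ v σ → CompTyping S (Γ.ext σ) c C →
      CompTyping S Γ (.letIn v c) C
  | ret {r t : ℕ} {Γ : Ctx r t} {v : Val} {A : Ty r t} (E : Row r) :
      ValTyping S Γ v (.mono A) → CompTyping S Γ (.ret v) ⟨A, E⟩
  | hand {r t : ℕ} {Γ : Ctx r t} {v : Val} {c : Comp} {A B : Ty r t} {E F : Row r} :
      ValTyping S Γ v (.mono (.hand A F B E)) → CompTyping S Γ c ⟨A, F⟩ →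
      CompTyping S Γ (.handle v c) ⟨B, E⟩
  | op {r t : ℕ} {Γ : Ctx r t} {l : ℕ} {v : Val} {c : Comp}
      {A₁ A₂ : Ty 0 0} {A₃ : Ty r t} {E : Row r} :
      S.op l = some (A₁, A₂) →
      ValTyping S Γ v (.mono (A₁.closed r t)) →
      CompTyping S (Γ.extTy (A₂.closed r t)) c ⟨A₃, E⟩ →
      E.Mem (.op l) →
      CompTyping S Γ (.op l v c) ⟨A₃, E⟩
  | sc {r t : ℕ} {Γ : Ctx r t} {l : ℕ} {v : Val} {c₁ c₂ : Comp}
      {A₁ A₂ : Ty 0 0} {A₃ A₄ : Ty r t} {E : Row r} :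
      S.sc l = some (A₁, A₂) →
      ValTyping S Γ v (.mono (A₁.closed r t)) →
      CompTyping S (Γ.extTy (A₂.closed r t)) c₁ ⟨A₃, E⟩ →
      CompTyping S (Γ.extTy A₃) c₂ ⟨A₄, E⟩ →
      E.Mem (.sc l) →
      CompTyping S Γ (.sc l v c₁ c₂) ⟨A₄, E⟩

/-- Return clause typing `Γ ⊢ return x ↦ cr : M A ! ⟨E⟩`, where `x : A`. -/
inductive RetTyping (S : Sig) : {r t : ℕ} → Ctx r t → Comp → Ty r t → Row r → Prop
  | ret {r t : ℕ} {Γ : Ctx r t} {cr : Comp} {M A : Ty r t} {E : Row r} :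
      CompTyping S (Γ.extTy A) cr ⟨.app M A, E⟩ →
      RetTyping S Γ cr (.app M A) E

/-- Operation clause typing `Γ ⊢ ops : C`. -/
inductive OprsTyping (S : Sig) : {r t : ℕ} → Ctx r t → Oprs → CTy r t → Prop
  | nil {r t : ℕ} {Γ : Ctx r t} {C : CTy r t} : OprsTyping S Γ .nil C
  | op {r t : ℕ} {Γ : Ctx r t} {l : ℕ} {c : Comp} {ops : Oprs}
      {A₁ A₂ : Ty 0 0} {B : Ty r t} {E : Row r} :
      OprsTyping S Γ ops ⟨B, E⟩ →
      S.op l = some (A₁, A₂) →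
      CompTyping S ((Γ.extTy (A₁.closed r t)).extTy (.fn (A₂.closed r t) B E)) c ⟨B, E⟩ →
      OprsTyping S Γ (.op l c ops) ⟨B, E⟩
  /-- the context of the clause body is
  `Γ, β, x : A₂, p : A₃ → M β ! ⟨E⟩, k : β → M A₁ ! ⟨E⟩` -/
  | sc {r t : ℕ} {Γ : Ctx r t} {l : ℕ} {c : Comp} {ops : Oprs}
      {A₂ A₃ : Ty 0 0} {M A₁ : Ty r t} {E : Row r} :
      OprsTyping S Γ ops ⟨.app M A₁, E⟩ →
      S.sc l = some (A₂, A₃) →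
      CompTyping S
        (((Γ.tyVar.extTy (A₂.closed r (t + 1))).extTy
          (.fn (A₃.closed r (t + 1)) (.app M.wk (.var 0)) E)).extTy
          (.fn (.var 0) (.app M.wk A₁.wk) E))
        c ⟨.app M.wk A₁.wk, E⟩ →
      OprsTyping S Γ (.sc l c ops) ⟨.app M A₁, E⟩

/-- Forwarding clause typing `Γ ⊢ fwd f p k ↦ cf : M A ! ⟨E⟩`; the context of the clause body is
`Γ, α, β, p : α → M β ! ⟨E⟩, k : β → M A ! ⟨E⟩,
f : ∀ γ δ . (α → γ ! ⟨E⟩, γ → δ ! ⟨E⟩) → δ ! ⟨E⟩`. -/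
inductive FwdTyping (S : Sig) : {r t : ℕ} → Ctx r t → Comp → Ty r t → Row r → Prop
  | fwd {r t : ℕ} {Γ : Ctx r t} {cf : Comp} {M A : Ty r t} {E : Row r} :
      CompTyping S
        (((Γ.tyVar.tyVar.extTy
          (.fn (.var 1) (.app M.wk.wk (.var 0)) E)).extTy
          (.fn (.var 0) (.app M.wk.wk A.wk.wk) E)).ext
          (fwdScheme E))
        cf ⟨.app M.wk.wk A.wk.wk, E⟩ →
      FwdTyping S Γ cf (.app M A) E

end

end LambdaSc

namespace LambdaSc

/-! ### Substitution in rows, types and schemes -/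

theorem Row.rename_eq_subst {r r' : ℕ} (ξ : Fin r → Fin r') (E : Row r) :
    E.rename ξ = E.subst (fun i => .var (ξ i)) := by
  induction E <;> simp_all [Row.rename, Row.subst]

theorem Row.subst_var {r : ℕ} (E : Row r) : E.subst Row.var = E := by
  induction E <;> simp_all [Row.subst]

theorem Row.subst_subst {r r' r'' : ℕ} (η : Fin r → Row r') (η' : Fin r' → Row r'')
    (E : Row r) : (E.subst η).subst η' = E.subst (fun i => (η i).subst η') := by
  induction E <;> simp_all [Row.subst]

theorem Row.lift_var {r r' : ℕ} (ξ : Fin r → Fin r') :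
    Row.lift (fun i => .var (ξ i)) = fun i => .var (liftFin ξ i) := by
  funext i; cases i using Fin.cases <;> rfl

theorem Ty.lift_var {r t t' : ℕ} (ρ : Fin t → Fin t') :
    Ty.lift (r := r) (fun i => .var (ρ i)) = fun i => .var (liftFin ρ i) := by
  funext i; cases i using Fin.cases <;> rfl

theorem liftFin_id {n : ℕ} : liftFin (fun i : Fin n => i) = fun i => i := by
  funext i; cases i using Fin.cases <;> rfl

theorem Row.lift_var_id {r : ℕ} : Row.lift (Row.var (r := r)) = Row.var :=
  (Row.lift_var fun i => i).trans (by rw [liftFin_id])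

theorem Ty.lift_var_id {r t : ℕ} : Ty.lift (Ty.var (r := r) (t := t)) = Ty.var :=
  (Ty.lift_var fun i => i).trans (by rw [liftFin_id])

theorem Ty.rename_eq_subst {r r' t t' : ℕ} (ξ : Fin r → Fin r') (ρ : Fin t → Fin t')
    (A : Ty r t) :
    A.rename ξ ρ = A.subst (fun i => .var (ξ i)) (fun i => .var (ρ i)) := by
  induction A generalizing t' <;>
    simp_all [Ty.rename, Ty.subst, Row.rename_eq_subst, Ty.lift_var]

theorem Ty.subst_var {r t : ℕ} (A : Ty r t) : A.subst Row.var Ty.var = A := by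
  induction A <;> simp_all [Ty.subst, Row.subst_var, Ty.lift_var_id]

theorem Ty.rename_subst {r r' r'' t t' t'' : ℕ} (ξ : Fin r → Fin r') (ρ : Fin t → Fin t')
    (η : Fin r' → Row r'') (θ : Fin t' → Ty r'' t'') (A : Ty r t) :
    (A.rename ξ ρ).subst η θ = A.subst (fun i => η (ξ i)) (fun i => θ (ρ i)) := by
  induction A generalizing t' t'' with
  | lam A ih =>
    simp only [Ty.rename, Ty.subst, ih, Ty.lam.injEq]
    congr 1
    funext i; cases i using Fin.cases <;> rfl
  | _ => simp_all [Ty.rename, Ty.subst, Row.rename_eq_subst, Row.subst_subst, Row.subst]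

theorem Ty.rename_rename {r r' r'' t t' t'' : ℕ} (ξ : Fin r → Fin r') (ρ : Fin t → Fin t')
    (ξ' : Fin r' → Fin r'') (ρ' : Fin t' → Fin t'') (A : Ty r t) :
    (A.rename ξ ρ).rename ξ' ρ' = A.rename (fun i => ξ' (ξ i)) (fun i => ρ' (ρ i)) := by
  rw [Ty.rename_eq_subst ξ', Ty.rename_subst, Ty.rename_eq_subst]

theorem Ty.subst_rename {r r' r'' t t' t'' : ℕ} (η : Fin r → Row r') (θ : Fin t → Ty r' t')
    (ξ : Fin r' → Fin r'') (ρ : Fin t' → Fin t'') (A : Ty r t) :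
    (A.subst η θ).rename ξ ρ =
      A.subst (fun i => (η i).rename ξ) (fun i => (θ i).rename ξ ρ) := by
  induction A generalizing t' t'' with
  | lam A ih =>
    simp only [Ty.rename, Ty.subst, ih, Ty.lam.injEq]
    congr 1
    funext i; cases i using Fin.cases with
    | zero => rfl
    | succ i => simp only [Ty.lift, Fin.cases_succ, Ty.wk, Ty.rename_rename]; rfl
  | _ => simp_all [Ty.rename, Ty.subst, Row.rename_eq_subst, Row.subst_subst]

theorem Ty.lift_subst {r' r'' t t' t'' : ℕ} (θ : Fin t → Ty r' t') (η' : Fin r' → Row r'')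
    (θ' : Fin t' → Ty r'' t'') (i : Fin (t + 1)) :
    (Ty.lift θ i).subst η' (Ty.lift θ') = Ty.lift (fun i => (θ i).subst η' θ') i := by
  cases i using Fin.cases with
  | zero => rfl
  | succ i =>
    simp only [Ty.lift, Fin.cases_succ, Ty.wk, Ty.rename_subst, Ty.subst_rename]
    congr 1
    funext i
    simp only [Row.rename_eq_subst]
    exact (Row.subst_var _).symm

theorem Ty.subst_subst {r r' r'' t t' t'' : ℕ} (η : Fin r → Row r') (θ : Fin t → Ty r' t')
    (η' : Fin r' → Row r'') (θ' : Fin t' → Ty r'' t'') (A : Ty r t) :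
    (A.subst η θ).subst η' θ' =
      A.subst (fun i => (η i).subst η') (fun i => (θ i).subst η' θ') := by
  induction A generalizing t' t'' <;>
    simp_all [Ty.subst, Row.subst_subst, Ty.lift_subst]

theorem Ty.wk_subst_lift {r r' t t' : ℕ} (η : Fin r → Row r') (θ : Fin t → Ty r' t')
    (A : Ty r t) : A.wk.subst η (Ty.lift θ) = (A.subst η θ).wk := by
  simp only [Ty.wk, Ty.rename_eq_subst, Ty.subst_subst]
  simp only [Ty.subst, Row.subst]
  congr 1
  · funext i; exact (Row.subst_var _).symm
  · funext i; exact Ty.rename_eq_subst _ _ _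

theorem Ty.wk_subst_cons {r r' t t' : ℕ} (η : Fin r → Row r') (θ : Fin t → Ty r' t')
    (A : Ty r t) (B : Ty r' t') : A.wk.subst η (Fin.cases B θ) = A.subst η θ := by
  simp only [Ty.wk, Ty.rename_subst]
  rfl

theorem Ty.inst_subst {r r' t t' : ℕ} (η : Fin r → Row r') (θ : Fin t → Ty r' t')
    (A : Ty r (t + 1)) (B : Ty r t) :
    (A.inst B).subst η θ = (A.subst η (Ty.lift θ)).inst (B.subst η θ) := by
  simp only [Ty.inst, Ty.subst_subst]
  congr 1
  · funext i; exact (Row.subst_var _).symm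
  · funext i; cases i using Fin.cases with
    | zero => rfl
    | succ i => exact ((Ty.wk_subst_cons _ _ _ _).trans (Ty.subst_var _)).symm

theorem Ty.closed_subst {r r' t t' : ℕ} (η : Fin r → Row r') (θ : Fin t → Ty r' t')
    (A : Ty 0 0) : (A.closed r t).subst η θ = A.closed r' t' := by
  rw [Ty.closed, Ty.rename_subst, Ty.closed, Ty.rename_eq_subst]
  congr 1 <;> funext i <;> exact i.elim0

theorem Row.lift_subst {r r' r'' : ℕ} (η : Fin r → Row r') (η' : Fin r' → Row r'')
    (i : Fin (r + 1)) :
    (Row.lift η i).subst (Row.lift η') = Row.lift (fun i => (η i).subst η') i := by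
  cases i using Fin.cases with
  | zero => rfl
  | succ i =>
    simp only [Row.lift, Fin.cases_succ, Row.rename_eq_subst, Row.subst_subst, Row.subst]

theorem Ty.wkRow_subst_lift {r r' t t' : ℕ} (η : Fin r → Row r') (θ : Fin t → Ty r' t')
    (A : Ty r t) :
    A.wkRow.subst (Row.lift η) (fun i => (θ i).wkRow) = (A.subst η θ).wkRow := by
  simp only [Ty.wkRow, Ty.rename_subst, Ty.subst_rename]
  rfl

theorem Scheme.subst_subst {r r' r'' t t' t'' : ℕ} (η : Fin r → Row r') (θ : Fin t → Ty r' t')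
    (η' : Fin r' → Row r'') (θ' : Fin t' → Ty r'' t'') (σ : Scheme r t) :
    (σ.subst η θ).subst η' θ' =
      σ.subst (fun i => (η i).subst η') (fun i => (θ i).subst η' θ') := by
  induction σ generalizing r' t' r'' t'' <;>
    simp_all [Scheme.subst, Ty.subst_subst, Ty.lift_subst, Row.lift_subst, Ty.wkRow_subst_lift]

theorem Scheme.subst_var {r t : ℕ} (σ : Scheme r t) : σ.subst Row.var Ty.var = σ := by
  induction σ with
  | mono A => simp [Scheme.subst, Ty.subst_var]
  | allTy σ ih => simp [Scheme.subst, Ty.lift_var_id, ih]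
  | allRow σ ih =>
    simp only [Scheme.subst, Row.lift_var_id]
    exact congrArg _ ih

theorem Scheme.rename_eq_subst {r r' t t' : ℕ} (ξ : Fin r → Fin r') (ρ : Fin t → Fin t')
    (σ : Scheme r t) :
    σ.rename ξ ρ = σ.subst (fun i => .var (ξ i)) (fun i => .var (ρ i)) := by
  induction σ generalizing r' t' with
  | mono A => simp [Scheme.rename, Scheme.subst, Ty.rename_eq_subst]
  | allTy σ ih => simp [Scheme.rename, Scheme.subst, Ty.lift_var, ih]
  | allRow σ ih =>
    simp only [Scheme.rename, Scheme.subst, Row.lift_var, ih]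
    rfl

theorem Scheme.wkTy_subst_lift {r r' t t' : ℕ} (η : Fin r → Row r') (θ : Fin t → Ty r' t')
    (σ : Scheme r t) : σ.wkTy.subst η (Ty.lift θ) = (σ.subst η θ).wkTy := by
  simp only [Scheme.wkTy, Scheme.rename_eq_subst, Scheme.subst_subst]
  simp only [Ty.subst, Row.subst]
  congr 1
  · funext i; exact (Row.subst_var _).symm
  · funext i; exact Ty.rename_eq_subst _ _ _

theorem Scheme.wkRow_subst_lift {r r' t t' : ℕ} (η : Fin r → Row r') (θ : Fin t → Ty r' t')
    (σ : Scheme r t) :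
    σ.wkRow.subst (Row.lift η) (fun i => (θ i).wkRow) = (σ.subst η θ).wkRow := by
  simp only [Scheme.wkRow, Scheme.rename_eq_subst, Scheme.subst_subst]
  simp only [Ty.subst, Row.subst]
  congr 1
  · funext i; exact Row.rename_eq_subst _ _
  · funext i; exact Ty.rename_eq_subst _ _ _

theorem Scheme.wkTy_subst_cons {r r' t t' : ℕ} (η : Fin r → Row r') (θ : Fin t → Ty r' t')
    (σ : Scheme r t) (B : Ty r' t') : σ.wkTy.subst η (Fin.cases B θ) = σ.subst η θ := by
  simp only [Scheme.wkTy, Scheme.rename_eq_subst, Scheme.subst_subst]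
  rfl

theorem Scheme.wkRow_subst_cons {r r' t t' : ℕ} (η : Fin r → Row r') (θ : Fin t → Ty r' t')
    (σ : Scheme r t) (E : Row r') : σ.wkRow.subst (Fin.cases E η) θ = σ.subst η θ := by
  simp only [Scheme.wkRow, Scheme.rename_eq_subst, Scheme.subst_subst]
  rfl

theorem Scheme.subst_lift_instTy {r r' t t' : ℕ} (η : Fin r → Row r') (θ : Fin t → Ty r' t')
    (σ : Scheme r (t + 1)) (A : Ty r' t') :
    (σ.subst η (Ty.lift θ)).instTy A = σ.subst η (Fin.cases A θ) := by
  simp only [Scheme.instTy, Scheme.subst_subst]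
  congr 1
  · funext i; exact Row.subst_var _
  · funext i; cases i using Fin.cases with
    | zero => rfl
    | succ i => exact (Ty.wk_subst_cons _ _ _ _).trans (Ty.subst_var _)

theorem Scheme.subst_lift_instRow {r r' t t' : ℕ} (η : Fin r → Row r') (θ : Fin t → Ty r' t')
    (σ : Scheme (r + 1) t) (E : Row r') :
    (σ.subst (Row.lift η) (fun i => (θ i).wkRow)).instRow E =
      σ.subst (Fin.cases E η) θ := by
  simp only [Scheme.instRow, Scheme.subst_subst]
  congr 1
  · funext i; cases i using Fin.cases with
    | zero => rfl
    | succ i =>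
      simp only [Row.lift, Fin.cases_succ, Row.rename_eq_subst, Row.subst_subst]
      exact Row.subst_var _
  · funext i
    simp only [Ty.wkRow, Ty.rename_subst]
    exact Ty.subst_var _

theorem Scheme.instTy_subst {r r' t t' : ℕ} (η : Fin r → Row r') (θ : Fin t → Ty r' t')
    (σ : Scheme r (t + 1)) (A : Ty r t) :
    (σ.instTy A).subst η θ = (σ.subst η (Ty.lift θ)).instTy (A.subst η θ) := by
  rw [Scheme.subst_lift_instTy, Scheme.instTy, Scheme.subst_subst]
  congr 1
  funext i; cases i using Fin.cases <;> rfl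

theorem Scheme.instRow_subst {r r' t t' : ℕ} (η : Fin r → Row r') (θ : Fin t → Ty r' t')
    (σ : Scheme (r + 1) t) (E : Row r) :
    (σ.instRow E).subst η θ =
      (σ.subst (Row.lift η) (fun i => (θ i).wkRow)).instRow (E.subst η) := by
  rw [Scheme.subst_lift_instRow, Scheme.instRow, Scheme.subst_subst]
  congr 1
  funext i; cases i using Fin.cases <;> rfl

theorem fwdScheme_subst_eq {r r' t t' : ℕ} (η : Fin r → Row r')
    (θ : Fin (t + 2) → Ty r' t') {A : Ty r' t'} (h : θ 1 = A) (E : Row r) :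
    (fwdScheme (t := t) E).subst η θ = .allTy (.allTy (.mono
      (.fn (.pair (.fn A.wk.wk (.var 1) (E.subst η)) (.fn (.var 1) (.var 0) (E.subst η)))
        (.var 0) (E.subst η)))) := by
  have h : Ty.lift (Ty.lift θ) 3 = A.wk.wk := h ▸ rfl
  simp only [fwdScheme, Scheme.subst, Ty.subst, h]
  rfl

theorem fwdScheme_subst {r r' t t' : ℕ} (η : Fin r → Row r') (θ : Fin (t + 2) → Ty r' (t' + 2))
    (h : θ 1 = .var 1) (E : Row r) :
    (fwdScheme (t := t) E).subst η θ = fwdScheme (E.subst η) :=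
  fwdScheme_subst_eq η θ h E

/-! ### Equivalence is stable under substitution -/

theorem RowEq.subst {r r' : ℕ} (η : Fin r → Row r') {E F : Row r} (h : RowEq E F) :
    RowEq (E.subst η) (F.subst η) := by
  induction h with
  | refl => exact .refl _
  | symm _ ih => exact .symm ih
  | trans _ _ ih₁ ih₂ => exact .trans ih₁ ih₂
  | head l _ ih => exact .head l ih
  | swap E hl => exact .swap _ hl

theorem Row.Mem.subst {r r' : ℕ} (η : Fin r → Row r') {l : Label} {E : Row r} (h : E.Mem l) :
    (E.subst η).Mem l :=
  let ⟨E', hE⟩ := h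
  ⟨E'.subst η, hE.subst η⟩

theorem TyEq.subst {r r' t t' : ℕ} (η : Fin r → Row r') (θ : Fin t → Ty r' t') {A B : Ty r t}
    (h : TyEq A B) : TyEq (A.subst η θ) (B.subst η θ) := by
  induction h generalizing t' with
  | refl => exact .refl _
  | symm _ ih => exact .symm (ih θ)
  | trans _ _ ih₁ ih₂ => exact .trans (ih₁ θ) (ih₂ θ)
  | pair _ _ ih₁ ih₂ => exact .pair (ih₁ θ) (ih₂ θ)
  | fn _ _ hE ih₁ ih₂ => exact .fn (ih₁ θ) (ih₂ θ) (hE.subst η)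
  | hand _ hF _ hE ih₁ ih₂ => exact .hand (ih₁ θ) (hF.subst η) (ih₂ θ) (hE.subst η)
  | lam _ ih => exact .lam (ih _)
  | app _ _ ih₁ ih₂ => exact .app (ih₁ θ) (ih₂ θ)
  | appAbs A B => rw [Ty.inst_subst]; exact .appAbs _ _

/-- Substitution in a computation type. -/
def CTy.subst {r r' t t' : ℕ} (η : Fin r → Row r') (θ : Fin t → Ty r' t') (C : CTy r t) :
    CTy r' t' :=
  ⟨C.ty.subst η θ, C.row.subst η⟩

theorem CTyEq.subst {r r' t t' : ℕ} (η : Fin r → Row r') (θ : Fin t → Ty r' t') {C D : CTy r t}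
    (h : CTyEq C D) : CTyEq (C.subst η θ) (D.subst η θ) :=
  ⟨h.ty.subst η θ, h.row.subst η⟩

/-! ### Confluence of type-level reduction -/

/-- Parallel reduction of value types, with rows taken up to equivalence. -/
inductive Ty.Par {r : ℕ} : {t : ℕ} → Ty r t → Ty r t → Prop
  | unit {t : ℕ} : Par (.unit : Ty r t) .unit
  | var {t : ℕ} (α : Fin t) : Par (.var α : Ty r t) (.var α)
  | pair {t : ℕ} {A₁ A₂ B₁ B₂ : Ty r t} :
      Par A₁ A₂ → Par B₁ B₂ → Par (.pair A₁ B₁) (.pair A₂ B₂)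
  | fn {t : ℕ} {A₁ A₂ B₁ B₂ : Ty r t} {E₁ E₂ : Row r} :
      Par A₁ A₂ → Par B₁ B₂ → RowEq E₁ E₂ → Par (.fn A₁ B₁ E₁) (.fn A₂ B₂ E₂)
  | hand {t : ℕ} {A₁ A₂ B₁ B₂ : Ty r t} {F₁ F₂ E₁ E₂ : Row r} :
      Par A₁ A₂ → RowEq F₁ F₂ → Par B₁ B₂ → RowEq E₁ E₂ →
      Par (.hand A₁ F₁ B₁ E₁) (.hand A₂ F₂ B₂ E₂)
  | lam {t : ℕ} {A B : Ty r (t + 1)} : Par A B → Par (.lam A) (.lam B)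
  | app {t : ℕ} {M₁ M₂ A B : Ty r t} :
      Par M₁ M₂ → Par A B → Par (.app M₁ A) (.app M₂ B)
  | beta {t : ℕ} {A A' : Ty r (t + 1)} {B B' : Ty r t} :
      Par A A' → Par B B' → Par (.app (.lam A) B) (A'.inst B')

theorem Ty.Par.refl {r t : ℕ} (A : Ty r t) : A.Par A := by
  induction A with
  | unit => exact .unit
  | pair _ _ ih₁ ih₂ => exact .pair ih₁ ih₂
  | fn _ _ E ih₁ ih₂ => exact .fn ih₁ ih₂ (.refl E)
  | hand _ F _ E ih₁ ih₂ => exact .hand ih₁ (.refl F) ih₂ (.refl E)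
  | var α => exact .var α
  | lam _ ih => exact .lam ih
  | app _ _ ih₁ ih₂ => exact .app ih₁ ih₂

theorem Ty.Par.tyEq {r t : ℕ} {A B : Ty r t} (h : A.Par B) : TyEq A B := by
  induction h with
  | unit => exact .refl _
  | var => exact .refl _
  | pair _ _ ih₁ ih₂ => exact .pair ih₁ ih₂
  | fn _ _ hE ih₁ ih₂ => exact .fn ih₁ ih₂ hE
  | hand _ hF _ hE ih₁ ih₂ => exact .hand ih₁ hF ih₂ hE
  | lam _ ih => exact .lam ih
  | app _ _ ih₁ ih₂ => exact .app ih₁ ih₂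
  | beta _ _ ih₁ ih₂ => exact .trans (.app (.lam ih₁) ih₂) (.appAbs _ _)

theorem Ty.Par.subst_same {r r' t t' : ℕ} (η : Fin r → Row r') (θ : Fin t → Ty r' t')
    {A B : Ty r t} (h : A.Par B) : (A.subst η θ).Par (B.subst η θ) := by
  induction h generalizing t' with
  | unit => exact .unit
  | var α => exact .refl _
  | pair _ _ ih₁ ih₂ => exact .pair (ih₁ θ) (ih₂ θ)
  | fn _ _ hE ih₁ ih₂ => exact .fn (ih₁ θ) (ih₂ θ) (hE.subst η)
  | hand _ hF _ hE ih₁ ih₂ => exact .hand (ih₁ θ) (hF.subst η) (ih₂ θ) (hE.subst η)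
  | lam _ ih => exact .lam (ih _)
  | app _ _ ih₁ ih₂ => exact .app (ih₁ θ) (ih₂ θ)
  | beta _ _ ih₁ ih₂ => rw [Ty.inst_subst]; exact .beta (ih₁ _) (ih₂ θ)

theorem Ty.Par.wk {r t : ℕ} {A B : Ty r t} (h : A.Par B) : A.wk.Par B.wk := by
  simp only [Ty.wk, Ty.rename_eq_subst]
  exact h.subst_same _ _

theorem Ty.Par.subst {r r' t t' : ℕ} (η : Fin r → Row r') {θ θ' : Fin t → Ty r' t'}
    (hθ : ∀ i, (θ i).Par (θ' i)) {A B : Ty r t} (h : A.Par B) :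
    (A.subst η θ).Par (B.subst η θ') := by
  have lift : ∀ {t t' : ℕ} {θ θ' : Fin t → Ty r' t'}, (∀ i, (θ i).Par (θ' i)) →
      ∀ i, (Ty.lift θ i).Par (Ty.lift θ' i) := by
    intro t t' θ θ' hθ i
    cases i using Fin.cases with
    | zero => exact .refl _
    | succ i => exact (hθ i).wk
  induction h generalizing t' with
  | unit => exact .unit
  | var α => exact hθ α
  | pair _ _ ih₁ ih₂ => exact .pair (ih₁ hθ) (ih₂ hθ)
  | fn _ _ hE ih₁ ih₂ => exact .fn (ih₁ hθ) (ih₂ hθ) (hE.subst η)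
  | hand _ hF _ hE ih₁ ih₂ => exact .hand (ih₁ hθ) (hF.subst η) (ih₂ hθ) (hE.subst η)
  | lam _ ih => exact .lam (ih (lift hθ))
  | app _ _ ih₁ ih₂ => exact .app (ih₁ hθ) (ih₂ hθ)
  | beta _ _ ih₁ ih₂ => rw [Ty.inst_subst]; exact .beta (ih₁ (lift hθ)) (ih₂ hθ)

theorem Ty.Par.inst {r t : ℕ} {A A' : Ty r (t + 1)} {B B' : Ty r t} (hA : A.Par A')
    (hB : B.Par B') : (A.inst B).Par (A'.inst B') := by
  refine hA.subst _ fun i => ?_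
  cases i using Fin.cases with
  | zero => exact hB
  | succ i => exact .refl _

/-- The complete development of a value type: all its redexes are contracted at once. -/
def Ty.develop {r : ℕ} : {t : ℕ} → Ty r t → Ty r t
  | _, .unit => .unit
  | _, .pair A B => .pair A.develop B.develop
  | _, .fn A B E => .fn A.develop B.develop E
  | _, .hand A F B E => .hand A.develop F B.develop E
  | _, .var α => .var α
  | _, .lam A => .lam A.develop
  | _, .app (.lam A) B => A.develop.inst B.develop
  | _, .app M A => .app M.develop A.develop

theorem Ty.Par.develop {r t : ℕ} {A B : Ty r t} (h : A.Par B) : B.Par A.develop := by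
  induction h with
  | unit => exact .unit
  | var α => exact .var α
  | pair _ _ ih₁ ih₂ => exact .pair ih₁ ih₂
  | fn _ _ hE ih₁ ih₂ => exact .fn ih₁ ih₂ hE.symm
  | hand _ hF _ hE ih₁ ih₂ => exact .hand ih₁ hF.symm ih₂ hE.symm
  | lam _ ih => exact .lam ih
  | @app _ M₁ M₂ A B hM _ ih₁ ih₂ =>
    cases M₁ with
    | lam N =>
      cases hM with
      | lam hN =>
        cases ih₁ with
        | lam ih => exact .beta ih ih₂
    | _ => exact .app ih₁ ih₂
  | beta _ _ ih₁ ih₂ => exact .inst ih₁ ih₂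

/-- Iterated parallel reduction. -/
abbrev Ty.Pars {r t : ℕ} : Ty r t → Ty r t → Prop :=
  Relation.ReflTransGen Ty.Par

theorem Ty.Pars.tyEq {r t : ℕ} {A B : Ty r t} (h : A.Pars B) : TyEq A B := by
  induction h with
  | refl => exact .refl _
  | tail _ h ih => exact .trans ih h.tyEq

theorem Ty.Pars.confluent {r t : ℕ} {A B C : Ty r t} (hB : A.Pars B) (hC : A.Pars C) :
    Relation.Join Ty.Pars B C :=
  Relation.church_rosser
    (fun A _ _ h₁ h₂ => ⟨A.develop, .single h₁.develop, .single h₂.develop⟩) hB hC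

theorem Ty.Pars.map₂ {r t t₁ t₂ : ℕ} {f : Ty r t₁ → Ty r t₂ → Ty r t}
    (hf : ∀ {A A' B B'}, A.Par A' → B.Par B' → (f A B).Par (f A' B'))
    {A A' : Ty r t₁} {B B' : Ty r t₂} (hA : A.Pars A') (hB : B.Pars B') :
    (f A B).Pars (f A' B') :=
  (hA.lift (fun X => f X B) fun _ _ h => hf h (.refl B)).trans
    (hB.lift (fun X => f A' X) fun _ _ h => hf (.refl A') h)

theorem TyEq.join {r t : ℕ} {A B : Ty r t} (h : TyEq A B) : Relation.Join Ty.Pars A B := by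
  induction h with
  | refl A => exact ⟨A, .refl, .refl⟩
  | symm _ ih => obtain ⟨C, h₁, h₂⟩ := ih; exact ⟨C, h₂, h₁⟩
  | trans _ _ ih₁ ih₂ =>
    obtain ⟨C, h₁, h₂⟩ := ih₁
    obtain ⟨D, h₃, h₄⟩ := ih₂
    obtain ⟨X, h₅, h₆⟩ := h₂.confluent h₃
    exact ⟨X, h₁.trans h₅, h₄.trans h₆⟩
  | pair _ _ ih₁ ih₂ =>
    obtain ⟨C, h₁, h₂⟩ := ih₁
    obtain ⟨D, h₃, h₄⟩ := ih₂
    exact ⟨_, Ty.Pars.map₂ Ty.Par.pair h₁ h₃, Ty.Pars.map₂ Ty.Par.pair h₂ h₄⟩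
  | @fn _ _ _ _ _ E₁ E₂ _ _ hE ih₁ ih₂ =>
    obtain ⟨C, h₁, h₂⟩ := ih₁
    obtain ⟨D, h₃, h₄⟩ := ih₂
    exact ⟨.fn C D E₂,
      (Ty.Pars.map₂ (f := (.fn · · E₁)) (fun h h' => .fn h h' (.refl _)) h₁ h₃).tail
        (.fn (.refl _) (.refl _) hE),
      Ty.Pars.map₂ (f := (.fn · · E₂)) (fun h h' => .fn h h' (.refl _)) h₂ h₄⟩
  | @hand _ _ _ _ _ F₁ F₂ E₁ E₂ _ hF _ hE ih₁ ih₂ =>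
    obtain ⟨C, h₁, h₂⟩ := ih₁
    obtain ⟨D, h₃, h₄⟩ := ih₂
    exact ⟨.hand C F₂ D E₂,
      (Ty.Pars.map₂ (f := (.hand · F₁ · E₁))
          (fun h h' => .hand h (.refl _) h' (.refl _)) h₁ h₃).tail
        (.hand (.refl _) hF (.refl _) hE),
      Ty.Pars.map₂ (f := (.hand · F₂ · E₂))
        (fun h h' => .hand h (.refl _) h' (.refl _)) h₂ h₄⟩
  | lam _ ih =>
    obtain ⟨C, h₁, h₂⟩ := ih
    exact ⟨.lam C, h₁.lift _ fun _ _ => .lam, h₂.lift _ fun _ _ => .lam⟩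
  | app _ _ ih₁ ih₂ =>
    obtain ⟨C, h₁, h₂⟩ := ih₁
    obtain ⟨D, h₃, h₄⟩ := ih₂
    exact ⟨_, Ty.Pars.map₂ Ty.Par.app h₁ h₃, Ty.Pars.map₂ Ty.Par.app h₂ h₄⟩
  | appAbs A B => exact ⟨A.inst B, .single (.beta (.refl A) (.refl B)), .refl⟩

theorem Ty.Pars.pair_inv {r t : ℕ} {A B X : Ty r t} (h : (Ty.pair A B).Pars X) :
    ∃ A' B', X = .pair A' B' ∧ TyEq A A' ∧ TyEq B B' := by
  induction h with
  | refl => exact ⟨A, B, rfl, .refl _, .refl _⟩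
  | tail _ h ih =>
    obtain ⟨A', B', rfl, hA, hB⟩ := ih
    cases h with
    | pair h₁ h₂ => exact ⟨_, _, rfl, hA.trans h₁.tyEq, hB.trans h₂.tyEq⟩

theorem Ty.Pars.fn_inv {r t : ℕ} {A B X : Ty r t} {E : Row r} (h : (Ty.fn A B E).Pars X) :
    ∃ A' B' E', X = .fn A' B' E' ∧ TyEq A A' ∧ TyEq B B' ∧ RowEq E E' := by
  induction h with
  | refl => exact ⟨A, B, E, rfl, .refl _, .refl _, .refl _⟩
  | tail _ h ih =>
    obtain ⟨A', B', E', rfl, hA, hB, hE⟩ := ih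
    cases h with
    | fn h₁ h₂ h₃ => exact ⟨_, _, _, rfl, hA.trans h₁.tyEq, hB.trans h₂.tyEq, hE.trans h₃⟩

theorem Ty.Pars.hand_inv {r t : ℕ} {A B X : Ty r t} {F E : Row r}
    (h : (Ty.hand A F B E).Pars X) :
    ∃ A' F' B' E', X = .hand A' F' B' E' ∧ TyEq A A' ∧ RowEq F F' ∧ TyEq B B' ∧
      RowEq E E' := by
  induction h with
  | refl => exact ⟨A, F, B, E, rfl, .refl _, .refl _, .refl _, .refl _⟩
  | tail _ h ih =>
    obtain ⟨A', F', B', E', rfl, hA, hF, hB, hE⟩ := ih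
    cases h with
    | hand h₁ h₂ h₃ h₄ =>
      exact ⟨_, _, _, _, rfl, hA.trans h₁.tyEq, hF.trans h₂, hB.trans h₃.tyEq, hE.trans h₄⟩

theorem TyEq.pair_inj {r t : ℕ} {A₁ A₂ B₁ B₂ : Ty r t}
    (h : TyEq (.pair A₁ B₁) (.pair A₂ B₂)) : TyEq A₁ A₂ ∧ TyEq B₁ B₂ := by
  obtain ⟨X, h₁, h₂⟩ := h.join
  obtain ⟨A, B, rfl, hA, hB⟩ := h₁.pair_inv
  obtain ⟨_, _, h, hA', hB'⟩ := h₂.pair_inv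
  cases h
  exact ⟨hA.trans hA'.symm, hB.trans hB'.symm⟩

theorem TyEq.fn_inj {r t : ℕ} {A₁ A₂ B₁ B₂ : Ty r t} {E₁ E₂ : Row r}
    (h : TyEq (.fn A₁ B₁ E₁) (.fn A₂ B₂ E₂)) :
    TyEq A₁ A₂ ∧ TyEq B₁ B₂ ∧ RowEq E₁ E₂ := by
  obtain ⟨X, h₁, h₂⟩ := h.join
  obtain ⟨A, B, E, rfl, hA, hB, hE⟩ := h₁.fn_inv
  obtain ⟨_, _, _, h, hA', hB', hE'⟩ := h₂.fn_inv
  cases h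
  exact ⟨hA.trans hA'.symm, hB.trans hB'.symm, hE.trans hE'.symm⟩

theorem TyEq.hand_inj {r t : ℕ} {A₁ A₂ B₁ B₂ : Ty r t} {F₁ F₂ E₁ E₂ : Row r}
    (h : TyEq (.hand A₁ F₁ B₁ E₁) (.hand A₂ F₂ B₂ E₂)) :
    TyEq A₁ A₂ ∧ RowEq F₁ F₂ ∧ TyEq B₁ B₂ ∧ RowEq E₁ E₂ := by
  obtain ⟨X, h₁, h₂⟩ := h.join
  obtain ⟨A, F, B, E, rfl, hA, hF, hB, hE⟩ := h₁.hand_inv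
  obtain ⟨_, _, _, _, h, hA', hF', hB', hE'⟩ := h₂.hand_inv
  cases h
  exact ⟨hA.trans hA'.symm, hF.trans hF'.symm, hB.trans hB'.symm, hE.trans hE'.symm⟩

/-! ### Labels in rows -/

/-- `ℓ` occurs in the row. -/
def Row.Occurs {r : ℕ} (l : Label) : Row r → Prop
  | .nil => False
  | .var _ => False
  | .cons l' E => l' = l ∨ E.Occurs l

theorem RowEq.occurs_iff {r : ℕ} {l : Label} {E F : Row r} (h : RowEq E F) :
    E.Occurs l ↔ F.Occurs l := by
  induction h with
  | refl => rfl
  | symm _ ih => exact ih.symm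
  | trans _ _ ih₁ ih₂ => exact ih₁.trans ih₂
  | head l _ ih => simp [Row.Occurs, ih]
  | swap E _ => simp [Row.Occurs, or_left_comm]

theorem Row.Occurs.mem {r : ℕ} {l : Label} {E : Row r} (h : E.Occurs l) : E.Mem l := by
  induction E with
  | nil => exact h.elim
  | var => exact h.elim
  | cons l' E ih =>
    by_cases e : l' = l
    · exact ⟨E, e ▸ .refl _⟩
    · obtain ⟨E', hE⟩ := ih (h.resolve_left e)
      exact ⟨.cons l' E', (hE.head l').trans (.swap _ e)⟩

theorem Row.mem_iff_occurs {r : ℕ} {l : Label} {E : Row r} : E.Mem l ↔ E.Occurs l :=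
  ⟨fun ⟨_, h⟩ => h.occurs_iff.2 (Or.inl rfl), Row.Occurs.mem⟩

theorem RowEq.mem_iff {r : ℕ} {l : Label} {E F : Row r} (h : RowEq E F) :
    E.Mem l ↔ F.Mem l := by
  rw [Row.mem_iff_occurs, Row.mem_iff_occurs, h.occurs_iff]

theorem Oprs.occurs_labels_op {r l : ℕ} {E : Row r} : (ops : Oprs) →
    (¬ ∃ c, ops.HasOp l c) → (ops.labels E).Occurs (.op l) → E.Occurs (.op l)
  | .nil, _, hE => hE
  | .op _ c ops, h, hE =>
      ops.occurs_labels_op (fun ⟨c, hc⟩ => h ⟨c, .inr hc⟩)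
        (hE.resolve_left fun e => h ⟨c, .inl ⟨Label.op.inj e, rfl⟩⟩)
  | .sc _ _ ops, h, hE => ops.occurs_labels_op h (hE.resolve_left nofun)

theorem Oprs.occurs_labels_sc {r l : ℕ} {E : Row r} : (ops : Oprs) →
    (¬ ∃ c, ops.HasSc l c) → (ops.labels E).Occurs (.sc l) → E.Occurs (.sc l)
  | .nil, _, hE => hE
  | .op _ _ ops, h, hE => ops.occurs_labels_sc h (hE.resolve_left nofun)
  | .sc _ c ops, h, hE =>
      ops.occurs_labels_sc (fun ⟨c, hc⟩ => h ⟨c, .inr hc⟩)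
        (hE.resolve_left fun e => h ⟨c, .inl ⟨Label.sc.inj e, rfl⟩⟩)

/-! ### Substitution in typing derivations -/

theorem Oprs.labels_subst {r r' : ℕ} (η : Fin r → Row r') (E : Row r) : (ops : Oprs) →
    (ops.labels E).subst η = ops.labels (E.subst η)
  | .nil => rfl
  | .op _ _ ops => congrArg _ (ops.labels_subst η E)
  | .sc _ _ ops => congrArg _ (ops.labels_subst η E)

theorem Oprs.labels_rename {r : ℕ} (ρ : ℕ → ℕ) (E : Row r) : (ops : Oprs) →
    (ops.rename ρ).labels E = ops.labels E
  | .nil => rfl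
  | .op _ _ ops => congrArg (Row.cons _) (ops.labels_rename ρ E)
  | .sc _ _ ops => congrArg (Row.cons _) (ops.labels_rename ρ E)

theorem Oprs.labels_termSubst {r : ℕ} (τ : ℕ → Val) (E : Row r) : (ops : Oprs) →
    (ops.subst τ).labels E = ops.labels E
  | .nil => rfl
  | .op _ _ ops => congrArg (Row.cons _) (ops.labels_termSubst τ E)
  | .sc _ _ ops => congrArg (Row.cons _) (ops.labels_termSubst τ E)

theorem liftRen_id : liftRen id = id := by
  funext n; cases n <;> rfl

mutual

theorem Val.rename_id : (v : Val) → v.rename id = v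
  | .unit => rfl
  | .pair v₁ v₂ => by simp only [Val.rename, v₁.rename_id, v₂.rename_id]
  | .var _ => rfl
  | .lam c => by simp only [Val.rename, liftRen_id, c.rename_id]
  | .lamPair c => by simp only [Val.rename, liftRen_id, c.rename_id]
  | .handler cr ops cf => by
      simp only [Val.rename, liftRen_id, cr.rename_id, ops.rename_id, cf.rename_id]

theorem Comp.rename_id : (c : Comp) → c.rename id = c
  | .ret v => by simp only [Comp.rename, v.rename_id]
  | .op l v c => by simp only [Comp.rename, liftRen_id, v.rename_id, c.rename_id]
  | .sc l v c₁ c₂ => by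
      simp only [Comp.rename, liftRen_id, v.rename_id, c₁.rename_id, c₂.rename_id]
  | .handle v c => by simp only [Comp.rename, v.rename_id, c.rename_id]
  | .seq c₁ c₂ => by simp only [Comp.rename, liftRen_id, c₁.rename_id, c₂.rename_id]
  | .app v₁ v₂ => by simp only [Comp.rename, v₁.rename_id, v₂.rename_id]
  | .letIn v c => by simp only [Comp.rename, liftRen_id, v.rename_id, c.rename_id]

theorem Oprs.rename_id : (ops : Oprs) → ops.rename id = ops
  | .nil => rfl
  | .op l c ops => by simp only [Oprs.rename, liftRen_id, c.rename_id, ops.rename_id]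
  | .sc l c ops => by simp only [Oprs.rename, liftRen_id, c.rename_id, ops.rename_id]

end

/-- Renaming the term variables by `ρ` and substituting for the row and type variables by `η`
and `θ` turns every assumption of `Γ` into an assumption of `Γ'`. -/
def Ctx.Maps {r r' t t' : ℕ} (Γ : Ctx r t) (Γ' : Ctx r' t') (ρ : ℕ → ℕ)
    (η : Fin r → Row r') (θ : Fin t → Ty r' t') : Prop :=
  ∀ ⦃x σ⦄, Γ.Has x σ → Γ'.Has (ρ x) (σ.subst η θ)

namespace Ctx.Maps

variable {r r' t t' : ℕ} {Γ : Ctx r t} {Γ' : Ctx r' t'} {ρ : ℕ → ℕ}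
  {η : Fin r → Row r'} {θ : Fin t → Ty r' t'}

theorem ext (h : Γ.Maps Γ' ρ η θ) (σ : Scheme r t) :
    (Γ.ext σ).Maps (Γ'.ext (σ.subst η θ)) (liftRen ρ) η θ := by
  intro x σ' hx
  cases hx with
  | here => exact .here _ _
  | there _ hx => exact .there _ (h hx)

theorem extTy (h : Γ.Maps Γ' ρ η θ) (A : Ty r t) :
    (Γ.extTy A).Maps (Γ'.extTy (A.subst η θ)) (liftRen ρ) η θ :=
  h.ext (.mono A)

theorem tyVar (h : Γ.Maps Γ' ρ η θ) : Γ.tyVar.Maps Γ'.tyVar ρ η (Ty.lift θ) := by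
  intro x σ hx
  cases hx with
  | tyVar hx => rw [Scheme.wkTy_subst_lift]; exact .tyVar (h hx)

theorem rowVar (h : Γ.Maps Γ' ρ η θ) :
    Γ.rowVar.Maps Γ'.rowVar ρ (Row.lift η) (fun i => (θ i).wkRow) := by
  intro x σ hx
  cases hx with
  | rowVar hx => rw [Scheme.wkRow_subst_lift]; exact .rowVar (h hx)

theorem instTy (h : Γ.Maps Γ' ρ η θ) (A : Ty r' t') :
    Γ.tyVar.Maps Γ' ρ η (Fin.cases A θ) := by
  intro x σ hx
  cases hx with
  | tyVar hx => rw [Scheme.wkTy_subst_cons]; exact h hx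

theorem instRow (h : Γ.Maps Γ' ρ η θ) (E : Row r') :
    Γ.rowVar.Maps Γ' ρ (Fin.cases E η) θ := by
  intro x σ hx
  cases hx with
  | rowVar hx => rw [Scheme.wkRow_subst_cons]; exact h hx

end Ctx.Maps

theorem Ctx.maps_succ {r t : ℕ} (Γ : Ctx r t) (σ : Scheme r t) :
    Γ.Maps (Γ.ext σ) Nat.succ Row.var Ty.var := by
  intro x σ' hx
  rw [Scheme.subst_var]
  exact .there _ hx

theorem Ctx.maps_id {r t : ℕ} (Γ : Ctx r t) : Γ.Maps Γ id Row.var Ty.var := by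
  intro x σ hx
  rw [Scheme.subst_var]
  exact hx

theorem Ctx.maps_tyVar {r t : ℕ} (Γ : Ctx r t) :
    Γ.Maps Γ.tyVar id Row.var (fun i => .var i.succ) := by
  intro x σ hx
  have := Has.tyVar hx
  rwa [Scheme.wkTy, Scheme.rename_eq_subst] at this

theorem Ctx.maps_rowVar {r t : ℕ} (Γ : Ctx r t) :
    Γ.Maps Γ.rowVar id (fun i => .var i.succ) Ty.var := by
  intro x σ hx
  have := Has.rowVar hx
  rwa [Scheme.wkRow, Scheme.rename_eq_subst] at this

variable {S : Sig}

mutual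

theorem ValTyping.map {r t : ℕ} {Γ : Ctx r t} {v : Val} {σ : Scheme r t}
    {r' t' : ℕ} {Γ' : Ctx r' t'} {ρ : ℕ → ℕ} {η : Fin r → Row r'} {θ : Fin t → Ty r' t'}
    (m : Γ.Maps Γ' ρ η θ) : ValTyping S Γ v σ →
    ValTyping S Γ' (v.rename ρ) (σ.subst η θ)
  | .var h => .var (m h)
  | .unit => .unit
  | .pair h₁ h₂ => .pair (h₁.map m) (h₂.map m)
  | .abs h => .abs (h.map (m.extTy _))
  | .absPair h => .absPair (h.map ((m.extTy _).extTy _))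
  | .eqV h e => .eqV (h.map m) (e.subst η θ)
  | .inst A h => by rw [Scheme.instTy_subst]; exact .inst _ (h.map m)
  | .gen h => .gen (h.map m.tyVar)
  | .instEff E h => by rw [Scheme.instRow_subst]; exact .instEff _ (h.map m)
  | .genEff h => .genEff (h.map m.rowVar)
  | .handler (M := M) (ops := ops) (E := E) (F := F) hF hr ho hf => by
      have hr := hr.map m.tyVar
      have ho := ho.map m.tyVar
      have hf := hf.map m.tyVar
      have hF := hF.subst η
      simp only [CTy.subst, Ty.subst, Ty.wk_subst_lift] at hr ho hf
      simp only [Scheme.subst, Ty.subst, Ty.wk_subst_lift]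
      rw [Oprs.labels_subst] at hF
      exact .handler (by rwa [Oprs.labels_rename]) hr ho hf

theorem CompTyping.map {r t : ℕ} {Γ : Ctx r t} {c : Comp} {C : CTy r t}
    {r' t' : ℕ} {Γ' : Ctx r' t'} {ρ : ℕ → ℕ} {η : Fin r → Row r'} {θ : Fin t → Ty r' t'}
    (m : Γ.Maps Γ' ρ η θ) : CompTyping S Γ c C →
    CompTyping S Γ' (c.rename ρ) (C.subst η θ)
  | .app h₁ h₂ => .app (h₁.map m) (h₂.map m)
  | .seq h₁ h₂ => by
      have h₁ := h₁.map m
      have h₂ := h₂.map (m.extTy _)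
      exact .seq h₁ h₂
  | .eqC h e => .eqC (h.map m) (e.subst η θ)
  | .letIn h₁ h₂ => .letIn (h₁.map m) (h₂.map (m.ext _))
  | .ret E h => .ret _ (h.map m)
  | .hand h₁ h₂ => .hand (h₁.map m) (h₂.map m)
  | .op hl hv hc hE => by
      have hv := hv.map m
      have hc := hc.map (m.extTy _)
      rw [Ty.closed_subst] at hc
      rw [Scheme.subst, Ty.closed_subst] at hv
      exact .op hl hv hc (hE.subst η)
  | .sc hl hv hc₁ hc₂ hE => by
      have hv := hv.map m
      have hc₁ := hc₁.map (m.extTy _)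
      rw [Ty.closed_subst] at hc₁
      rw [Scheme.subst, Ty.closed_subst] at hv
      exact .sc hl hv hc₁ (hc₂.map (m.extTy _)) (hE.subst η)

theorem RetTyping.map {r t : ℕ} {Γ : Ctx r t} {c : Comp} {A : Ty r t} {E : Row r}
    {r' t' : ℕ} {Γ' : Ctx r' t'} {ρ : ℕ → ℕ} {η : Fin r → Row r'} {θ : Fin t → Ty r' t'}
    (m : Γ.Maps Γ' ρ η θ) : RetTyping S Γ c A E →
    RetTyping S Γ' (c.rename (liftRen ρ)) (A.subst η θ) (E.subst η)
  | .ret h => .ret (h.map (m.extTy _))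

theorem OprsTyping.map {r t : ℕ} {Γ : Ctx r t} {ops : Oprs} {C : CTy r t}
    {r' t' : ℕ} {Γ' : Ctx r' t'} {ρ : ℕ → ℕ} {η : Fin r → Row r'} {θ : Fin t → Ty r' t'}
    (m : Γ.Maps Γ' ρ η θ) : OprsTyping S Γ ops C →
    OprsTyping S Γ' (ops.rename ρ) (C.subst η θ)
  | .nil => .nil
  | .op ho hl hc => by
      have hc := hc.map ((m.extTy _).extTy _)
      simp only [Ty.subst, Ty.closed_subst] at hc
      exact .op (ho.map m) hl hc
  | .sc ho hl hc => by
      have hc := hc.map (((m.tyVar.extTy _).extTy _).extTy _)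
      simp only [CTy.subst, Ty.subst, Ty.closed_subst, Ty.wk_subst_lift] at hc
      exact .sc (ho.map m) hl hc

theorem FwdTyping.map {r t : ℕ} {Γ : Ctx r t} {c : Comp} {A : Ty r t} {E : Row r}
    {r' t' : ℕ} {Γ' : Ctx r' t'} {ρ : ℕ → ℕ} {η : Fin r → Row r'} {θ : Fin t → Ty r' t'}
    (m : Γ.Maps Γ' ρ η θ) : FwdTyping S Γ c A E →
    FwdTyping S Γ' (c.rename (liftRen (liftRen (liftRen ρ)))) (A.subst η θ) (E.subst η)
  | .fwd h => by
      have h := h.map (((m.tyVar.tyVar.extTy _).extTy _).ext _)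
      rw [fwdScheme_subst η (Ty.lift (Ty.lift θ)) rfl] at h
      simp only [CTy.subst, Ty.subst, Ty.wk_subst_lift] at h
      exact .fwd h

end

theorem ValTyping.weaken {r t : ℕ} {Γ : Ctx r t} {v : Val} {σ : Scheme r t}
    (h : ValTyping S Γ v σ) (σ' : Scheme r t) :
    ValTyping S (Γ.ext σ') (v.rename Nat.succ) σ := by
  simpa only [Scheme.subst_var] using h.map (Γ.maps_succ σ')

theorem CompTyping.weaken_under {r t : ℕ} {Γ : Ctx r t} {A : Ty r t} {c : Comp} {C : CTy r t}
    (h : CompTyping S (Γ.extTy A) c C) (A' : Ty r t) :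
    CompTyping S ((Γ.extTy A').extTy A) (c.rename (liftRen Nat.succ)) C := by
  have := h.map ((Γ.maps_succ (.mono A')).extTy A)
  simp only [CTy.subst, Ty.subst_var, Row.subst_var] at this
  exact this

theorem ValTyping.wkTy {r t : ℕ} {Γ : Ctx r t} {v : Val} {σ : Scheme r t}
    (h : ValTyping S Γ v σ) : ValTyping S Γ.tyVar v σ.wkTy := by
  have := h.map Γ.maps_tyVar
  rw [Val.rename_id] at this
  rwa [Scheme.wkTy, Scheme.rename_eq_subst]

theorem ValTyping.wkRow {r t : ℕ} {Γ : Ctx r t} {v : Val} {σ : Scheme r t}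
    (h : ValTyping S Γ v σ) : ValTyping S Γ.rowVar v σ.wkRow := by
  have := h.map Γ.maps_rowVar
  rw [Val.rename_id] at this
  rwa [Scheme.wkRow, Scheme.rename_eq_subst]

/-- The values `τ x` have in `Γ'` the types that `Γ` assumes for the variables `x`. -/
def Ctx.TermSubst {r t : ℕ} (S : Sig) (Γ Γ' : Ctx r t) (τ : ℕ → Val) : Prop :=
  ∀ ⦃x σ⦄, Γ.Has x σ → ValTyping S Γ' (τ x) σ

namespace Ctx.TermSubst

variable {r t : ℕ} {Γ Γ' : Ctx r t} {τ : ℕ → Val}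

theorem cons (h : Γ.TermSubst S Γ' τ) {v : Val} {σ : Scheme r t} (hv : ValTyping S Γ' v σ) :
    (Γ.ext σ).TermSubst S Γ' (scons v τ) := by
  intro x σ' hx
  cases hx with
  | here => exact hv
  | there _ hx => exact h hx

theorem ext (h : Γ.TermSubst S Γ' τ) (σ : Scheme r t) :
    (Γ.ext σ).TermSubst S (Γ'.ext σ) (liftSub τ) :=
  cons (fun _ _ hx => (h hx).weaken σ) (.var (.here _ _))

theorem extTy (h : Γ.TermSubst S Γ' τ) (A : Ty r t) :
    (Γ.extTy A).TermSubst S (Γ'.extTy A) (liftSub τ) :=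
  h.ext (.mono A)

theorem tyVar (h : Γ.TermSubst S Γ' τ) : Γ.tyVar.TermSubst S Γ'.tyVar τ := by
  intro x σ hx
  cases hx with
  | tyVar hx => exact (h hx).wkTy

theorem rowVar (h : Γ.TermSubst S Γ' τ) : Γ.rowVar.TermSubst S Γ'.rowVar τ := by
  intro x σ hx
  cases hx with
  | rowVar hx => exact (h hx).wkRow

end Ctx.TermSubst

theorem Ctx.termSubst_var {r t : ℕ} (Γ : Ctx r t) : Γ.TermSubst S Γ Val.var :=
  fun _ _ h => .var h

mutual

theorem ValTyping.subst {r t : ℕ} {Γ Γ' : Ctx r t} {v : Val} {σ : Scheme r t} {τ : ℕ → Val}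
    (m : Γ.TermSubst S Γ' τ) : ValTyping S Γ v σ → ValTyping S Γ' (v.subst τ) σ
  | .var h => m h
  | .unit => .unit
  | .pair h₁ h₂ => .pair (h₁.subst m) (h₂.subst m)
  | .abs h => .abs (h.subst (m.extTy _))
  | .absPair h => .absPair (h.subst ((m.extTy _).extTy _))
  | .eqV h e => .eqV (h.subst m) e
  | .inst A h => .inst A (h.subst m)
  | .gen h => .gen (h.subst m.tyVar)
  | .instEff E h => .instEff E (h.subst m)
  | .genEff h => .genEff (h.subst m.rowVar)
  | .handler hF hr ho hf =>
      .handler (by rwa [Oprs.labels_termSubst]) (hr.subst m.tyVar) (ho.subst m.tyVar)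
        (hf.subst m.tyVar)

theorem CompTyping.subst {r t : ℕ} {Γ Γ' : Ctx r t} {c : Comp} {C : CTy r t} {τ : ℕ → Val}
    (m : Γ.TermSubst S Γ' τ) : CompTyping S Γ c C → CompTyping S Γ' (c.subst τ) C
  | .app h₁ h₂ => .app (h₁.subst m) (h₂.subst m)
  | .seq h₁ h₂ => .seq (h₁.subst m) (h₂.subst (m.extTy _))
  | .eqC h e => .eqC (h.subst m) e
  | .letIn h₁ h₂ => .letIn (h₁.subst m) (h₂.subst (m.ext _))
  | .ret E h => .ret E (h.subst m)
  | .hand h₁ h₂ => .hand (h₁.subst m) (h₂.subst m)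
  | .op hl hv hc hE => .op hl (hv.subst m) (hc.subst (m.extTy _)) hE
  | .sc hl hv hc₁ hc₂ hE =>
      .sc hl (hv.subst m) (hc₁.subst (m.extTy _)) (hc₂.subst (m.extTy _)) hE

theorem RetTyping.subst {r t : ℕ} {Γ Γ' : Ctx r t} {c : Comp} {A : Ty r t} {E : Row r}
    {τ : ℕ → Val} (m : Γ.TermSubst S Γ' τ) :
    RetTyping S Γ c A E → RetTyping S Γ' (c.subst (liftSub τ)) A E
  | .ret h => .ret (h.subst (m.extTy _))

theorem OprsTyping.subst {r t : ℕ} {Γ Γ' : Ctx r t} {ops : Oprs} {C : CTy r t} {τ : ℕ → Val}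
    (m : Γ.TermSubst S Γ' τ) : OprsTyping S Γ ops C → OprsTyping S Γ' (ops.subst τ) C
  | .nil => .nil
  | .op ho hl hc => .op (ho.subst m) hl (hc.subst ((m.extTy _).extTy _))
  | .sc ho hl hc => .sc (ho.subst m) hl (hc.subst (((m.tyVar.extTy _).extTy _).extTy _))

theorem FwdTyping.subst {r t : ℕ} {Γ Γ' : Ctx r t} {c : Comp} {A : Ty r t} {E : Row r}
    {τ : ℕ → Val} (m : Γ.TermSubst S Γ' τ) :
    FwdTyping S Γ c A E → FwdTyping S Γ' (c.subst (liftSub (liftSub (liftSub τ)))) A E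
  | .fwd h => .fwd (h.subst (((m.tyVar.tyVar.extTy _).extTy _).ext _))

end

theorem CompTyping.inst {r t : ℕ} {Γ : Ctx r t} {c : Comp} {v : Val} {σ : Scheme r t}
    {C : CTy r t} (h : CompTyping S (Γ.ext σ) c C) (hv : ValTyping S Γ v σ) :
    CompTyping S Γ (c.inst v) C :=
  h.subst (Γ.termSubst_var.cons hv)

theorem CompTyping.inst₂ {r t : ℕ} {Γ : Ctx r t} {c : Comp} {v w : Val} {σ₁ σ₂ : Scheme r t}
    {C : CTy r t} (h : CompTyping S ((Γ.ext σ₁).ext σ₂) c C) (hv : ValTyping S Γ v σ₁)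
    (hw : ValTyping S Γ w σ₂) : CompTyping S Γ (c.inst₂ v w) C :=
  h.subst ((Γ.termSubst_var.cons hv).cons hw)

theorem CompTyping.inst₃ {r t : ℕ} {Γ : Ctx r t} {c : Comp} {u v w : Val}
    {σ₁ σ₂ σ₃ : Scheme r t} {C : CTy r t}
    (h : CompTyping S (((Γ.ext σ₁).ext σ₂).ext σ₃) c C) (hu : ValTyping S Γ u σ₁)
    (hv : ValTyping S Γ v σ₂) (hw : ValTyping S Γ w σ₃) :
    CompTyping S Γ (c.inst₃ u v w) C :=
  h.subst (((Γ.termSubst_var.cons hu).cons hv).cons hw)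

theorem CompTyping.tySubst {r r' t t' : ℕ} {Γ : Ctx r t} {Γ' : Ctx r' t'} {c : Comp}
    {C : CTy r t} {η : Fin r → Row r'} {θ : Fin t → Ty r' t'} (m : Γ.Maps Γ' id η θ)
    (h : CompTyping S Γ c C) : CompTyping S Γ' c (C.subst η θ) := by
  simpa only [Comp.rename_id] using h.map m

theorem Ctx.Maps.ext_id {r r' t t' : ℕ} {Γ : Ctx r t} {Γ' : Ctx r' t'} {η : Fin r → Row r'}
    {θ : Fin t → Ty r' t'} (m : Γ.Maps Γ' id η θ) (σ : Scheme r t) :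
    (Γ.ext σ).Maps (Γ'.ext (σ.subst η θ)) id η θ := by
  simpa only [liftRen_id] using m.ext σ

theorem Ctx.Maps.extTy_id {r r' t t' : ℕ} {Γ : Ctx r t} {Γ' : Ctx r' t'} {η : Fin r → Row r'}
    {θ : Fin t → Ty r' t'} (m : Γ.Maps Γ' id η θ) (A : Ty r t) :
    (Γ.extTy A).Maps (Γ'.extTy (A.subst η θ)) id η θ :=
  m.ext_id (.mono A)

/-! ### Inversion of typing derivations -/

/-- `T` is obtained from the scheme by instantiating all its quantifiers. -/
inductive Scheme.Inst {r t : ℕ} : Scheme r t → Ty r t → Prop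
  | mono (A : Ty r t) : Inst (.mono A) A
  | allTy {σ : Scheme r (t + 1)} {T : Ty r t} (A : Ty r t) :
      Inst (σ.instTy A) T → Inst (.allTy σ) T
  | allRow {σ : Scheme (r + 1) t} {T : Ty r t} (E : Row r) :
      Inst (σ.instRow E) T → Inst (.allRow σ) T

/-- The premises under which `handler {return x ↦ cr, ops, fwd f p k ↦ cf}` has the type
`∀ α . α ! ⟨F⟩ ⇒ M α ! ⟨E⟩`. -/
structure HandlerTyping (S : Sig) {r t : ℕ} (Γ : Ctx r t) (cr : Comp) (ops : Oprs) (cf : Comp)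
    (M : Ty r t) (F E : Row r) : Prop where
  row : RowEq F (ops.labels E)
  ret : RetTyping S Γ.tyVar cr (.app M.wk (.var 0)) E
  ops : OprsTyping S Γ.tyVar ops ⟨.app M.wk (.var 0), E⟩
  fwd : FwdTyping S Γ.tyVar cf (.app M.wk (.var 0)) E

theorem HandlerTyping.tySubst {r r' t t' : ℕ} {Γ : Ctx r t} {Γ' : Ctx r' t'} {cr : Comp}
    {ops : Oprs} {cf : Comp} {M : Ty r t} {F E : Row r} {η : Fin r → Row r'}
    {θ : Fin t → Ty r' t'} (m : Γ.Maps Γ' id η θ) (h : HandlerTyping S Γ cr ops cf M F E) :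
    HandlerTyping S Γ' cr ops cf (M.subst η θ) (F.subst η) (E.subst η) := by
  have hr := h.ret.map m.tyVar
  have ho := h.ops.map m.tyVar
  have hf := h.fwd.map m.tyVar
  have hF := h.row.subst η
  simp only [CTy.subst, Ty.subst, Ty.wk_subst_lift, liftRen_id, Comp.rename_id,
    Oprs.rename_id] at hr ho hf
  rw [Oprs.labels_subst] at hF
  exact ⟨hF, hr, ho, hf⟩

theorem hand_instTy {r t : ℕ} (M A : Ty r t) (F E : Row r) :
    (Scheme.mono (.hand (.var 0) F (.app M.wk (.var 0)) E)).instTy A =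
      .mono (.hand A F (.app M A) E) := by
  simp only [Scheme.instTy, Scheme.subst, Ty.subst, Ty.wk_subst_cons, Ty.subst_var,
    Row.subst_var, Fin.cases_zero]

theorem HandlerTyping.valTyping {r t : ℕ} {Γ : Ctx r t} {cr : Comp} {ops : Oprs} {cf : Comp}
    {M : Ty r t} {F E : Row r} (h : HandlerTyping S Γ cr ops cf M F E) (A : Ty r t) :
    ValTyping S Γ (.handler cr ops cf) (.mono (.hand A F (.app M A) E)) := by
  rw [← hand_instTy]
  exact .inst A (.handler h.row h.ret h.ops h.fwd)

/-- What the typing of a value at a type implies for its immediate subterms. -/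
def Val.Inverted (S : Sig) {r t : ℕ} (Γ : Ctx r t) (T : Ty r t) : Val → Prop
  | .pair v₁ v₂ => ∃ A B, TyEq (.pair A B) T ∧
      ValTyping S Γ v₁ (.mono A) ∧ ValTyping S Γ v₂ (.mono B)
  | .lam c => ∃ A B E, TyEq (.fn A B E) T ∧ CompTyping S (Γ.extTy A) c ⟨B, E⟩
  | .lamPair c => ∃ A₁ A₂ B E, TyEq (.fn (.pair A₁ A₂) B E) T ∧
      CompTyping S ((Γ.extTy A₁).extTy A₂) c ⟨B, E⟩
  | .handler cr ops cf => ∃ M A F E, TyEq (.hand A F (.app M A) E) T ∧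
      HandlerTyping S Γ cr ops cf M F E
  | _ => True

theorem Val.Inverted.tyEq {r t : ℕ} {Γ : Ctx r t} {T T' : Ty r t} (e : TyEq T T') :
    {v : Val} → v.Inverted S Γ T → v.Inverted S Γ T'
  | .unit, h => h
  | .var _, h => h
  | .pair _ _, ⟨A, B, h, h'⟩ => ⟨A, B, h.trans e, h'⟩
  | .lam _, ⟨A, B, E, h, h'⟩ => ⟨A, B, E, h.trans e, h'⟩
  | .lamPair _, ⟨A₁, A₂, B, E, h, h'⟩ => ⟨A₁, A₂, B, E, h.trans e, h'⟩
  | .handler _ _ _, ⟨M, A, F, E, h, h'⟩ => ⟨M, A, F, E, h.trans e, h'⟩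

theorem ValTyping.inverted_of_inst {r t : ℕ} {Γ : Ctx r t} {v : Val} {σ : Scheme r t}
    {r' t' : ℕ} {Γ' : Ctx r' t'} {η : Fin r → Row r'} {θ : Fin t → Ty r' t'}
    (m : Γ.Maps Γ' id η θ) {T : Ty r' t'} : ValTyping S Γ v σ → (σ.subst η θ).Inst T →
    v.Inverted S Γ' T
  | .var _, _ => trivial
  | .unit, _ => trivial
  | .pair h₁ h₂, i => by
      cases i
      have h₁ := h₁.map m
      have h₂ := h₂.map m
      rw [Val.rename_id] at h₁ h₂
      exact ⟨_, _, .refl _, h₁, h₂⟩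
  | .abs h, i => by
      cases i
      exact ⟨_, _, _, .refl _, h.tySubst (m.extTy_id _)⟩
  | .absPair h, i => by
      cases i
      exact ⟨_, _, _, _, .refl _, h.tySubst ((m.extTy_id _).extTy_id _)⟩
  | .eqV h e, i => by
      cases i
      exact (h.inverted_of_inst m (.mono _)).tyEq (e.subst η θ)
  | .inst A h, i => by
      rw [Scheme.instTy_subst] at i
      exact h.inverted_of_inst m (.allTy _ i)
  | .gen h, i => by
      obtain - | ⟨A, i⟩ := i
      rw [Scheme.subst_lift_instTy] at i
      exact h.inverted_of_inst (m.instTy A) i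
  | .instEff E h, i => by
      rw [Scheme.instRow_subst] at i
      exact h.inverted_of_inst m (.allRow _ i)
  | .genEff h, i => by
      obtain - | - | ⟨E, i⟩ := i
      rw [Scheme.subst_lift_instRow] at i
      exact h.inverted_of_inst (m.instRow E) i
  | .handler hF hr ho hf, i => by
      obtain - | ⟨A, i⟩ := i
      have h := HandlerTyping.tySubst m ⟨hF, hr, ho, hf⟩
      simp only [Scheme.subst, Ty.subst, Ty.wk_subst_lift] at i
      erw [hand_instTy] at i
      cases i
      exact ⟨_, _, _, _, .refl _, h⟩

theorem ValTyping.inverted {r t : ℕ} {Γ : Ctx r t} {v : Val} {T : Ty r t}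
    (h : ValTyping S Γ v (.mono T)) : v.Inverted S Γ T :=
  h.inverted_of_inst Γ.maps_id (by rw [Scheme.subst_var]; exact .mono T)

/-- What the typing of a computation at a type implies for its immediate subterms. -/
def Comp.Inverted (S : Sig) {r t : ℕ} (Γ : Ctx r t) (C : CTy r t) : Comp → Prop
  | .ret v => ValTyping S Γ v (.mono C.ty)
  | .op l v c => ∃ A₁ A₂, S.op l = some (A₁, A₂) ∧
      ValTyping S Γ v (.mono (A₁.closed r t)) ∧
      CompTyping S (Γ.extTy (A₂.closed r t)) c C ∧ C.row.Mem (.op l)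
  | .sc l v c₁ c₂ => ∃ A₁ A₂ A₃, S.sc l = some (A₁, A₂) ∧
      ValTyping S Γ v (.mono (A₁.closed r t)) ∧
      CompTyping S (Γ.extTy (A₂.closed r t)) c₁ ⟨A₃, C.row⟩ ∧
      CompTyping S (Γ.extTy A₃) c₂ C ∧ C.row.Mem (.sc l)
  | .handle v c => ∃ A F, ValTyping S Γ v (.mono (.hand A F C.ty C.row)) ∧
      CompTyping S Γ c ⟨A, F⟩
  | .seq c₁ c₂ => ∃ A, CompTyping S Γ c₁ ⟨A, C.row⟩ ∧ CompTyping S (Γ.extTy A) c₂ C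
  | .app v₁ v₂ => ∃ A, ValTyping S Γ v₁ (.mono (.fn A C.ty C.row)) ∧
      ValTyping S Γ v₂ (.mono A)
  | .letIn v c => ∃ σ, ValTyping S Γ v σ ∧ CompTyping S (Γ.ext σ) c C

theorem Comp.Inverted.ctyEq {r t : ℕ} {Γ : Ctx r t} {C D : CTy r t} (e : CTyEq C D) :
    {c : Comp} → c.Inverted S Γ C → c.Inverted S Γ D
  | .ret _, h => .eqV h e.ty
  | .op _ _ _, ⟨A₁, A₂, hl, hv, hc, hE⟩ =>
      ⟨A₁, A₂, hl, hv, .eqC hc e, e.row.mem_iff.1 hE⟩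
  | .sc _ _ _ _, ⟨A₁, A₂, A₃, hl, hv, hc₁, hc₂, hE⟩ =>
      ⟨A₁, A₂, A₃, hl, hv, .eqC hc₁ ⟨.refl _, e.row⟩, .eqC hc₂ e, e.row.mem_iff.1 hE⟩
  | .handle _ _, ⟨A, F, hv, hc⟩ =>
      ⟨A, F, .eqV hv (.hand (.refl _) (.refl _) e.ty e.row), hc⟩
  | .seq _ _, ⟨A, hc₁, hc₂⟩ => ⟨A, .eqC hc₁ ⟨.refl _, e.row⟩, .eqC hc₂ e⟩
  | .app _ _, ⟨A, h₁, h₂⟩ => ⟨A, .eqV h₁ (.fn (.refl _) e.ty e.row), h₂⟩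
  | .letIn _ _, ⟨σ, hv, hc⟩ => ⟨σ, hv, .eqC hc e⟩

theorem CompTyping.inverted {r t : ℕ} {Γ : Ctx r t} {c : Comp} {C : CTy r t} :
    CompTyping S Γ c C → c.Inverted S Γ C
  | .app h₁ h₂ => ⟨_, h₁, h₂⟩
  | .seq h₁ h₂ => ⟨_, h₁, h₂⟩
  | .eqC h e => h.inverted.ctyEq e
  | .letIn h₁ h₂ => ⟨_, h₁, h₂⟩
  | .ret _ h => h
  | .hand h₁ h₂ => ⟨_, _, h₁, h₂⟩
  | .op hl hv hc hE => ⟨_, _, hl, hv, hc, hE⟩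
  | .sc hl hv hc₁ hc₂ hE => ⟨_, _, _, hl, hv, hc₁, hc₂, hE⟩

/-! ### Handling operations -/

theorem OprsTyping.hasOp {r t l : ℕ} {Γ : Ctx r t} {c : Comp} {B : Ty r t} {E : Row r}
    {A₁ A₂ : Ty 0 0} (hl : S.op l = some (A₁, A₂)) {ops : Oprs} :
    OprsTyping S Γ ops ⟨B, E⟩ → ops.HasOp l c →
    CompTyping S ((Γ.extTy (A₁.closed r t)).extTy (.fn (A₂.closed r t) B E)) c ⟨B, E⟩
  | .op ho hl' hc, h => by
      rcases h with ⟨rfl, rfl⟩ | h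
      · cases hl.symm.trans hl'
        exact hc
      · exact ho.hasOp hl h
  | .sc ho _ _, h => ho.hasOp hl h

theorem OprsTyping.hasSc {r t l : ℕ} {Γ : Ctx r t} {c : Comp} {M A : Ty r t} {E : Row r}
    {A₁ A₂ : Ty 0 0} (hl : S.sc l = some (A₁, A₂)) {ops : Oprs} :
    OprsTyping S Γ ops ⟨.app M A, E⟩ → ops.HasSc l c →
    CompTyping S
      (((Γ.tyVar.extTy (A₁.closed r (t + 1))).extTy
        (.fn (A₂.closed r (t + 1)) (.app M.wk (.var 0)) E)).extTy
        (.fn (.var 0) (.app M.wk A.wk) E))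
      c ⟨.app M.wk A.wk, E⟩
  | .op ho _ _, h => ho.hasSc hl h
  | .sc ho hl' hc, h => by
      rcases h with ⟨rfl, rfl⟩ | h
      · cases hl.symm.trans hl'
        exact hc
      · exact ho.hasSc hl h

theorem Ty.wk_closed {r t : ℕ} (A : Ty 0 0) : (A.closed r t).wk = A.closed r (t + 1) := by
  rw [Ty.wk, Ty.rename_eq_subst, Ty.closed_subst]

theorem ValTyping.forwarder {r t l : ℕ} {Γ : Ctx r t} {v : Val} {A₁ A₂ : Ty 0 0} {E : Row r}
    (hl : S.sc l = some (A₁, A₂)) (hv : ValTyping S Γ v (.mono (A₁.closed r t)))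
    (hE : E.Mem (.sc l)) :
    ValTyping S Γ (.forwarder l v)
      (.allTy (.allTy (.mono (.fn (.pair (.fn (A₂.closed r (t + 2)) (.var 1) E)
        (.fn (.var 1) (.var 0) E)) (.var 0) E)))) := by
  refine .gen (.gen (.absPair (.sc (A₃ := .var 1) hl ?_ (.app (.var (.there _ (.there _ (.here _ _))))
    (.var (.here _ _))) (.app (.var (.there _ (.here _ _))) (.var (.here _ _))) hE)))
  have hv := hv.wkTy.wkTy.map (ρ := fun n => n + 2) (η := Row.var) (θ := Ty.var)
    (Γ' := (Γ.tyVar.tyVar.extTy (.fn (A₂.closed r (t + 2)) (.var 1) E)).extTy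
      (.fn (.var 1) (.var 0) E))
    (fun _ _ h => by rw [Scheme.subst_var]; exact .there _ (.there _ h))
  have e : ((Scheme.mono (A₁.closed r t)).wkTy.wkTy) = .mono (A₁.closed r t).wk.wk := rfl
  rwa [e, Scheme.subst_var, Ty.wk_closed, Ty.wk_closed] at hv

namespace HandlerTyping

variable {r t : ℕ} {Γ : Ctx r t} {cr : Comp} {ops : Oprs} {cf : Comp} {M A : Ty r t}
  {F E : Row r}

theorem weaken (h : HandlerTyping S Γ cr ops cf M F E) (A : Ty r t) (B : Ty r t) :
    ValTyping S (Γ.extTy B) ((Val.handler cr ops cf).rename Nat.succ)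
      (.mono (.hand A F (.app M A) E)) :=
  (h.valTyping A).weaken _

theorem handled (h : HandlerTyping S Γ cr ops cf M F E) {B : Ty r t} {c : Comp}
    (hc : CompTyping S (Γ.extTy B) c ⟨A, F⟩) :
    ValTyping S Γ ((Val.handler cr ops cf).handled c) (.mono (.fn B (.app M A) E)) :=
  .abs (.hand (h.weaken A B) hc)

theorem handRet (h : HandlerTyping S Γ cr ops cf M F E) {v : Val}
    (hv : ValTyping S Γ v (.mono A)) : CompTyping S Γ (cr.inst v) ⟨.app M A, E⟩ := by
  obtain ⟨hc⟩ := h.ret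
  have := hc.tySubst ((Γ.maps_id.instTy A).extTy_id _)
  simp only [CTy.subst, Ty.subst, Ty.wk_subst_cons, Ty.subst_var, Row.subst_var,
    Fin.cases_zero] at this
  exact this.inst hv

theorem handOp (h : HandlerTyping S Γ cr ops cf M F E) {l : ℕ} {v : Val} {c₁ c : Comp}
    (hc : ops.HasOp l c) (hi : (Comp.op l v c₁).Inverted S Γ ⟨A, F⟩) :
    CompTyping S Γ (c.inst₂ v ((Val.handler cr ops cf).handled c₁)) ⟨.app M A, E⟩ := by
  obtain ⟨A₁, A₂, hl, hv, hc₁, -⟩ := hi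
  have := (h.ops.hasOp hl hc).tySubst (((Γ.maps_id.instTy A).extTy_id _).extTy_id _)
  simp only [CTy.subst, Ty.subst, Ty.wk_subst_cons, Ty.subst_var, Row.subst_var,
    Fin.cases_zero, Ty.closed_subst] at this
  exact this.inst₂ hv (h.handled hc₁)

theorem fwdOp (h : HandlerTyping S Γ cr ops cf M F E) {l : ℕ} {v : Val} {c₁ : Comp}
    (hn : ¬ ∃ c, ops.HasOp l c) (hi : (Comp.op l v c₁).Inverted S Γ ⟨A, F⟩) :
    CompTyping S Γ (.op l v (.handle ((Val.handler cr ops cf).rename Nat.succ) c₁))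
      ⟨.app M A, E⟩ := by
  obtain ⟨A₁, A₂, hl, hv, hc₁, hF⟩ := hi
  rw [h.row.mem_iff, Row.mem_iff_occurs] at hF
  exact .op hl hv (.hand (h.weaken A _) hc₁) (ops.occurs_labels_op hn hF).mem

theorem handSc (h : HandlerTyping S Γ cr ops cf M F E) {l : ℕ} {v : Val} {c₁ c₂ c : Comp}
    (hc : ops.HasSc l c) (hi : (Comp.sc l v c₁ c₂).Inverted S Γ ⟨A, F⟩) :
    CompTyping S Γ
      (c.inst₃ v ((Val.handler cr ops cf).handled c₁) ((Val.handler cr ops cf).handled c₂))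
      ⟨.app M A, E⟩ := by
  obtain ⟨A₁, A₂, A₃, hl, hv, hc₁, hc₂, -⟩ := hi
  have := (h.ops.hasSc hl hc).tySubst
    (((((Γ.maps_id.instTy A).instTy A₃).extTy_id _).extTy_id _).extTy_id _)
  simp only [CTy.subst, Ty.subst, Ty.wk_subst_cons, Ty.subst_var, Row.subst_var,
    Fin.cases_zero, Ty.closed_subst] at this
  exact this.inst₃ hv (h.handled hc₁) (h.handled hc₂)

theorem fwdSc (h : HandlerTyping S Γ cr ops cf M F E) {l : ℕ} {v : Val} {c₁ c₂ : Comp}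
    (hn : ¬ ∃ c, ops.HasSc l c) (hi : (Comp.sc l v c₁ c₂).Inverted S Γ ⟨A, F⟩) :
    CompTyping S Γ
      (cf.inst₃ ((Val.handler cr ops cf).handled c₁) ((Val.handler cr ops cf).handled c₂)
        (.forwarder l v))
      ⟨.app M A, E⟩ := by
  obtain ⟨A₁, A₂, A₃, hl, hv, hc₁, hc₂, hF⟩ := hi
  rw [h.row.mem_iff, Row.mem_iff_occurs] at hF
  have hf := ValTyping.forwarder hl hv (ops.occurs_labels_sc hn hF).mem
  obtain ⟨hc⟩ := h.fwd
  have := hc.tySubst (((((((Γ.maps_id.instTy A).instTy (A₂.closed _ _)).instTy A₃).extTy_id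
    _).extTy_id _).ext_id _))
  rw [fwdScheme_subst_eq (A := A₂.closed _ _) _ _ rfl] at this
  simp only [CTy.subst, Ty.subst, Ty.wk_subst_cons, Ty.subst_var, Row.subst_var,
    Fin.cases_zero, Ty.wk_closed] at this
  exact this.inst₃ (h.handled hc₁) (h.handled hc₂) hf

end HandlerTyping

theorem ValTyping.handler_inv {r t : ℕ} {Γ : Ctx r t} {cr : Comp} {ops : Oprs} {cf : Comp}
    {A B : Ty r t} {F E : Row r}
    (h : ValTyping S Γ (.handler cr ops cf) (.mono (.hand A F B E))) :
    ∃ M A' F' E', HandlerTyping S Γ cr ops cf M F' E' ∧ CTyEq ⟨A, F⟩ ⟨A', F'⟩ ∧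
      CTyEq ⟨.app M A', E'⟩ ⟨B, E⟩ := by
  obtain ⟨M, A', F', E', e, h⟩ := h.inverted
  obtain ⟨hA, hF, hB, hE⟩ := e.hand_inj
  exact ⟨M, A', F', E', h, ⟨hA.symm, hF.symm⟩, ⟨hB, hE⟩⟩

/-- A well typed `with h handle c` keeps its type under any transformation of `c` which does so
at all instances of the type of `h`. -/
theorem CompTyping.handle_handler {r t : ℕ} {Γ : Ctx r t} {cr : Comp} {ops : Oprs} {cf : Comp}
    {c c' : Comp} {C : CTy r t} (hc : CompTyping S Γ (.handle (.handler cr ops cf) c) C)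
    (H : ∀ M A F E, HandlerTyping S Γ cr ops cf M F E → c.Inverted S Γ ⟨A, F⟩ →
      CompTyping S Γ c' ⟨.app M A, E⟩) : CompTyping S Γ c' C := by
  obtain ⟨A, F, hv, hc⟩ := hc.inverted
  obtain ⟨M, A', F', E', h, e, e'⟩ := hv.handler_inv
  exact .eqC (H M A' F' E' h (hc.inverted.ctyEq e)) e'

theorem CompTyping.step {c c' : Comp} (hs : Step c c') {r t : ℕ} {Γ : Ctx r t} {C : CTy r t}
    (hc : CompTyping S Γ c C) : CompTyping S Γ c' C := by
  induction hs generalizing r t with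
  | appAbs c v =>
    obtain ⟨A, h, hv⟩ := hc.inverted
    obtain ⟨A', B, E, e, hc⟩ := h.inverted
    obtain ⟨hA, hB, hE⟩ := e.fn_inj
    exact .eqC (hc.inst (.eqV hv hA.symm)) ⟨hB, hE⟩
  | appAbsPair c v₁ v₂ =>
    obtain ⟨A, h, hv⟩ := hc.inverted
    obtain ⟨A₁, A₂, B, E, e, hc⟩ := h.inverted
    obtain ⟨hA, hB, hE⟩ := e.fn_inj
    obtain ⟨B₁, B₂, e, hv₁, hv₂⟩ := hv.inverted
    obtain ⟨h₁, h₂⟩ := (e.trans hA.symm).pair_inj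
    exact .eqC (hc.inst₂ (.eqV hv₁ h₁) (.eqV hv₂ h₂)) ⟨hB, hE⟩
  | letIn v c =>
    obtain ⟨σ, hv, hc⟩ := hc.inverted
    exact hc.inst hv
  | seq c₂ _ ih =>
    obtain ⟨A, h₁, h₂⟩ := hc.inverted
    exact .seq (ih h₁) h₂
  | seqRet v c₂ =>
    obtain ⟨A, h₁, h₂⟩ := hc.inverted
    exact h₂.inst h₁.inverted
  | seqOp l v c₁ c₂ =>
    obtain ⟨A, h, h₂⟩ := hc.inverted
    obtain ⟨A₁, A₂, hl, hv, h₁, hE⟩ := h.inverted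
    exact .op hl hv (.seq h₁ (h₂.weaken_under _)) hE
  | seqSc l v c₁ c₂ c₃ =>
    obtain ⟨A, h, h₃⟩ := hc.inverted
    obtain ⟨A₁, A₂, A₃, hl, hv, h₁, h₂, hE⟩ := h.inverted
    exact .sc hl hv h₁ (.seq h₂ (h₃.weaken_under _)) hE
  | hand cr ops cf _ ih =>
    obtain ⟨A, F, hv, hc⟩ := hc.inverted
    exact .hand hv (ih hc)
  | handRet cr ops cf v => exact hc.handle_handler fun _ _ _ _ h hi => h.handRet hi
  | handOp cr ops cf l v c₁ c hm => exact hc.handle_handler fun _ _ _ _ h hi => h.handOp hm hi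
  | fwdOp cr ops cf l v c₁ hn => exact hc.handle_handler fun _ _ _ _ h hi => h.fwdOp hn hi
  | handSc cr ops cf l v c₁ c₂ c hm =>
    exact hc.handle_handler fun _ _ _ _ h hi => h.handSc hm hi
  | fwdSc cr ops cf l v c₁ c₂ hn => exact hc.handle_handler fun _ _ _ _ h hi => h.fwdSc hn hi

end LambdaSc

/-- Subject reduction: if `Γ ⊢ c : C` and `c ⇝ c'`, then `Γ ⊢ c' : C'` for some `C' ≡ C`. -/
theorem mainTheorem1 (S : LambdaSc.Sig) {r t : ℕ} (Γ : LambdaSc.Ctx r t)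
    (c c' : LambdaSc.Comp) (C : LambdaSc.CTy r t)
    (hc : LambdaSc.CompTyping S Γ c C) (hstep : LambdaSc.Step c c') :
    ∃ C' : LambdaSc.CTy r t, LambdaSc.CTyEq C C' ∧ LambdaSc.CompTyping S Γ c' C' :=
  ⟨C, ⟨.refl _, .refl _⟩, hc.step hstep⟩
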